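/- **Theorem 3.4 (Filtration Theorem).** Let $F$ be a field of prime characteristic $p$, $G$ a group, $V$ an $FG$-module (of arbitrary dimension) and $r$ a positive integer. Write $T^i(V)$ for the $i$th tensor power of $V$, $L^i(V)$ for the $i$th Lie power (the intersection of $T^i(V)$ with the Lie subalgebra of the tensor algebra generated by $V$), and $S^m$ for the $m$th symmetric power. For a partition $\lambda=(r^{m(r)},\dots,1^{m(1)})$ of $r$ let $$L^\lambda(V)=S^{m(1)}(L^1(V))\otimes_F S^{m(2)}(L^2(V))\otimes_F\cdots\otimes_F S^{m(r)}(L^r(V))$$ be the corresponding higher Lie module. Let $\mathrm{Sym}(r)$ act on $\{1,\dots,r\}$ from the right, and on $T^r(V)$ from the left by $\sigma(v_1\cdots v_r)=v_{1\sigma}\cdots v_{r\sigma}$. For a composition $\nu$ of $r$ let $X^\nu\in F\,\mathrm{Sym}(r)$ be the sum of all $\pi$ for which the sequence $1\pi,2\pi,\dots,r\pi$ has descents only at partial sums of $\nu$. The $X^\nu$ form a basis of the descent algebra $D_{r,F}\subseteq F\,\mathrm{Sym}(r)$. Let $c_{r,F}$ be the linear map from $D_{r,F}$ to the $F$-valued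 class functions on $\mathrm{Sym}(r)$ which maps each $X^\nu$ to $\phi^\nu\cdot 1_F$, where $\phi^\nu$ is the character induced from the trivial character of the Young subgroup $\mathrm{Sym}(\nu_1)\times\cdots\times\mathrm{Sym}(\nu_k)$. Two partitions $\lambda,\theta$ of $r$ are $p$-equivalent if, for permutations $\sigma_\lambda,\sigma_\theta$ of cycle types $\lambda,\theta$, the elements $\sigma_\lambda^{p^s}$ and $\sigma_\theta^{p^s}$ are conjugate for some positive integer $s$. Let $\mathcal J$ be the set of $p$-equivalence classes of partitions of $r$. Let $(e_J)_{J\in\mathcal J}$ be pairwise orthogonal primitive idempotents of $D_{r,F}$ with $\sum_{J}e_J=1$ such that $c_{r,F}(e_J)$ takes the value $1$ on the conjugacy classes indexed by the partitions $\lambda\in J$ and the value $0$ on all others. Then every $e_JT^r(V)$ is an $FG$-submodule of $T^r(V)$, and $$T^r(V)=\bigoplus_{J\in\mathcal J}e_JT^r(V).$$ For a given $J$, let $\lambda(1),\dots,\lambda(s)$ be the partitions belonging to $J$ in increasing lexicographic order. Then $e_JT^r(V)$ has a filtration by $FG$-submodules $$e_JT^r(V)=U_1\ge U_2\ge\cdots\ge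 U_s\ge U_{s+1}=0$$ such that $U_j/U_{j+1}\cong L^{\lambda(j)}(V)$ as $FG$-modules for $j=1,\dots,s$. -/

import Mathlib

open scoped TensorProduct

namespace FiltrationTheorem

/-! ### Tensor powers and the two commuting actions on them -/

section TensorPowers

variable {F : Type*} [Field F] {G : Type*} [Group G] {V : Type*} [AddCommGroup V] [Module F V]

/-- The diagonal action of `G` on the `r`-th tensor power `T^r(V)`. -/
noncomputable def tensorRep (ρ : Representation F G V) (r : ℕ) :
    Representation F G (⨂[F]^r V) where
  toFun g := PiTensorProduct.map (fun _ => ρ g)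
  map_one' := by
    simp only [map_one]
    exact PiTensorProduct.map_one
  map_mul' g h := by
    simp only [map_mul]
    exact PiTensorProduct.map_mul _ _

variable (F V) in
/-- The left action of `Sym(r)` on `T^r(V)` by place permutations,
`σ (v₁ ⋯ v_r) = v_{1σ} ⋯ v_{rσ}`. Permutations act on points from the right, so that `στ` means
first `σ`, then `τ`; this group is the opposite of the group `Equiv.Perm (Fin r)`. -/
noncomputable def placeRep (r : ℕ) :
    Representation F (Equiv.Perm (Fin r))ᵐᵒᵖ (⨂[F]^r V) where
  toFun σ := (PiTensorProduct.reindex F (fun _ : Fin r => V) σ.unop.symm).toLinearMap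
  map_one' := by
    ext v
    simp only [LinearMap.compMultilinearMap_apply, LinearEquiv.coe_coe,
      PiTensorProduct.reindex_tprod]
    rfl
  map_mul' σ τ := by
    ext v
    simp only [LinearMap.compMultilinearMap_apply, LinearEquiv.coe_coe, Module.End.mul_apply,
      PiTensorProduct.reindex_tprod]
    rfl

theorem placeRep_tprod (r : ℕ) (σ : Equiv.Perm (Fin r)) (v : Fin r → V) :
    placeRep F V r (MulOpposite.op σ) (PiTensorProduct.tprod F v) =
      PiTensorProduct.tprod F (fun i => v (σ i)) := by
  simp [placeRep]

theorem placeRep_comm (ρ : Representation F G V) (r : ℕ) (g : G)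
    (x : MonoidAlgebra F (Equiv.Perm (Fin r))ᵐᵒᵖ) (t : ⨂[F]^r V) :
    tensorRep ρ r g ((placeRep F V r).asAlgebraHom x t) =
      (placeRep F V r).asAlgebraHom x (tensorRep ρ r g t) := by
  induction x using MonoidAlgebra.induction_linear with
  | zero => simp
  | add x y hx hy => simp [hx, hy]
  | single σ a =>
    simp only [Representation.asAlgebraHom_single, LinearMap.smul_apply, map_smul]
    congr 1
    rw [← LinearMap.comp_apply, ← LinearMap.comp_apply]
    congr 1
    ext v
    simp [tensorRep, placeRep]

/-- The `FG`-submodule `x T^r(V)` of `T^r(V)`, for an element `x` of the group algebra of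
`Sym(r)`. -/
noncomputable def placeImage (ρ : Representation F G V) {r : ℕ}
    (x : MonoidAlgebra F (Equiv.Perm (Fin r))ᵐᵒᵖ) : Subrepresentation (tensorRep ρ r) where
  toSubmodule := LinearMap.range ((placeRep F V r).asAlgebraHom x)
  apply_mem_toSubmodule := by
    rintro g _ ⟨t, rfl⟩
    exact ⟨tensorRep ρ r g t, (placeRep_comm ρ r g x t).symm⟩

end TensorPowers

/-! ### Lie powers, symmetric powers and higher Lie modules -/

section HigherLie

variable {F : Type*} [Field F] {G : Type*} [Group G] {V : Type*} [AddCommGroup V] [Module F V]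

attribute [local instance] LieRing.ofAssociativeRing

variable (F V) in
/-- The free Lie algebra `L(V)`: the Lie subalgebra of the tensor algebra generated by `V`. -/
noncomputable def freeLie : LieSubalgebra F (TensorAlgebra F V) :=
  LieSubalgebra.lieSpan F (TensorAlgebra F V) (Set.range (TensorAlgebra.ι F : V → TensorAlgebra F V))

/-- The algebra endomorphism of the tensor algebra which extends a linear endomorphism of `V`. -/
noncomputable def tensorAlgebraMap (f : V →ₗ[F] V) : TensorAlgebra F V →ₐ[F] TensorAlgebra F V :=
  TensorAlgebra.lift F (TensorAlgebra.ι F ∘ₗ f)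

theorem tensorAlgebraMap_mem (f : V →ₗ[F] V) {a : TensorAlgebra F V} (ha : a ∈ freeLie F V) :
    tensorAlgebraMap f a ∈ freeLie F V := by
  have h : freeLie F V ≤ (freeLie F V).comap
      ((tensorAlgebraMap f : TensorAlgebra F V →ₐ[F] TensorAlgebra F V) :
        TensorAlgebra F V →ₗ⁅F⁆ TensorAlgebra F V) := by
    refine LieSubalgebra.lieSpan_le.mpr ?_
    rintro _ ⟨v, rfl⟩
    refine LieSubalgebra.subset_lieSpan ⟨f v, ?_⟩
    simp [tensorAlgebraMap]
  exact h ha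

theorem toTensorAlgebra_tensorRep (ρ : Representation F G V) (r : ℕ) (g : G) (t : ⨂[F]^r V) :
    TensorPower.toTensorAlgebra (tensorRep ρ r g t) =
      tensorAlgebraMap (ρ g) (TensorPower.toTensorAlgebra t) := by
  have h : TensorPower.toTensorAlgebra ∘ₗ tensorRep ρ r g =
      (tensorAlgebraMap (ρ g)).toLinearMap ∘ₗ TensorPower.toTensorAlgebra := by
    ext v
    simp [tensorRep, tensorAlgebraMap, TensorAlgebra.tprod_apply, map_list_prod, List.map_ofFn,
      Function.comp_def]
  exact LinearMap.congr_fun h t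

/-- The Lie power `L^i(V) = T^i(V) ∩ L(V)`, as an `FG`-submodule of `T^i(V)`. -/
noncomputable def liePower (ρ : Representation F G V) (i : ℕ) :
    Subrepresentation (tensorRep ρ i) where
  toSubmodule := (freeLie F V).toSubmodule.comap TensorPower.toTensorAlgebra
  apply_mem_toSubmodule g t ht := by
    simp only [Submodule.mem_comap, LieSubalgebra.mem_toSubmodule] at ht ⊢
    rw [toTensorAlgebra_tensorRep]
    exact tensorAlgebraMap_mem _ ht

/-- The representation of `G` on the symmetric algebra `S(V)` by algebra automorphisms which
extends the action on `V`. -/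
noncomputable def symAlgebraRep (ρ : Representation F G V) :
    Representation F G (SymmetricAlgebra F V) where
  toFun g := (SymmetricAlgebra.lift (SymmetricAlgebra.ι F V ∘ₗ ρ g)).toLinearMap
  map_one' := by
    have h : SymmetricAlgebra.lift (SymmetricAlgebra.ι F V ∘ₗ ρ 1) =
        AlgHom.id F (SymmetricAlgebra F V) := by
      ext v
      simp
    rw [h]
    rfl
  map_mul' g g' := by
    have h : SymmetricAlgebra.lift (SymmetricAlgebra.ι F V ∘ₗ ρ (g * g')) =
        (SymmetricAlgebra.lift (SymmetricAlgebra.ι F V ∘ₗ ρ g)).comp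
          (SymmetricAlgebra.lift (SymmetricAlgebra.ι F V ∘ₗ ρ g')) := by
      ext v
      simp
    rw [h]
    rfl

/-- The symmetric power `S^m(V)`: the homogeneous component of degree `m` of `S(V)`, that is, the
span of all products of `m` elements of `V`. -/
noncomputable def symPower (ρ : Representation F G V) (m : ℕ) :
    Subrepresentation (symAlgebraRep ρ) where
  toSubmodule := LinearMap.range (SymmetricAlgebra.ι F V) ^ m
  apply_mem_toSubmodule g a ha := by
    have h : (LinearMap.range (SymmetricAlgebra.ι F V) ^ m).map
        (SymmetricAlgebra.lift (SymmetricAlgebra.ι F V ∘ₗ ρ g)).toLinearMap ≤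
          LinearMap.range (SymmetricAlgebra.ι F V) ^ m := by
      rw [Submodule.map_pow]
      refine pow_le_pow_left' ?_ m
      rintro _ ⟨_, ⟨v, rfl⟩, rfl⟩
      exact ⟨ρ g v, by simp⟩
    exact h ⟨a, ha, rfl⟩

/-- The factor `S^{m(i)}(L^i(V))` of the higher Lie module `L^μ(V)`, where `m(i)` is the
multiplicity of `i` in the partition `μ`. -/
noncomputable abbrev lieFactor (ρ : Representation F G V) {r : ℕ} (μ : r.Partition) (i : ℕ) :
    Subrepresentation (symAlgebraRep (liePower ρ i).toRepresentation) :=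
  symPower (liePower ρ i).toRepresentation (μ.parts.count i)

/-- The higher Lie module
`L^μ(V) = S^{m(1)}(L^1(V)) ⊗ S^{m(2)}(L^2(V)) ⊗ ⋯ ⊗ S^{m(r)}(L^r(V))`. -/
noncomputable def higherLie (ρ : Representation F G V) {r : ℕ} (μ : r.Partition) :
    Representation F G (⨂[F] i : Fin r, (lieFactor ρ μ ((i : ℕ) + 1)).toSubmodule) where
  toFun g := PiTensorProduct.map (fun i => (lieFactor ρ μ ((i : ℕ) + 1)).toRepresentation g)
  map_one' := by
    simp only [map_one]
    exact PiTensorProduct.map_one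
  map_mul' g h := by
    simp only [map_mul]
    exact PiTensorProduct.map_mul _ _

/-- The representation on the factor `A / B` for subrepresentations `B ≤ A` (without `B ≤ A` it is
`A / (A ∩ B)`). -/
noncomputable def factorRep {W : Type*} [AddCommGroup W] [Module F W] {τ : Representation F G W}
    (A B : Subrepresentation τ) :
    Representation F G (A.toSubmodule ⧸ B.toSubmodule.submoduleOf A.toSubmodule) :=
  A.toRepresentation.quotient (B.toSubmodule.submoduleOf A.toSubmodule)
    (fun g _ ha => B.apply_mem_toSubmodule g ha)

end HigherLie

/-! ### Partitions: cycle types, `p`-equivalence and the lexicographic order -/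

section Partitions

/-- The partition of `r` formed by the cycle lengths of `σ`, fixed points included. It indexes the
conjugacy class of `σ`. -/
def cycleShape {r : ℕ} (σ : Equiv.Perm (Fin r)) : r.Partition where
  parts := σ.partition.parts
  parts_pos := σ.partition.parts_pos
  parts_sum := by simpa using σ.partition.parts_sum

theorem isConj_iff_cycleShape {r : ℕ} {σ τ : Equiv.Perm (Fin r)} :
    IsConj σ τ ↔ cycleShape σ = cycleShape τ := by
  rw [Equiv.Perm.partition_eq_of_isConj, Nat.Partition.ext_iff, Nat.Partition.ext_iff]
  rfl

theorem exists_cycleShape {r : ℕ} (μ : r.Partition) :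
    ∃ σ : Equiv.Perm (Fin r), cycleShape σ = μ := by
  have hsplit : μ.parts = μ.parts.filter (2 ≤ ·) +
      Multiset.replicate (μ.parts.count 1) 1 := by
    rw [← Multiset.filter_eq']
    conv_lhs => rw [← Multiset.filter_add_not (2 ≤ ·) μ.parts]
    congr 1
    refine Multiset.filter_congr fun a ha => ?_
    have := μ.parts_pos ha
    omega
  have hsum : (μ.parts.filter (2 ≤ ·)).sum + μ.parts.count 1 = r := by
    have h := congrArg Multiset.sum hsplit
    rw [μ.parts_sum] at h
    simpa using h.symm
  obtain ⟨σ, hσ⟩ := (Equiv.Perm.exists_with_cycleType_iff (Fin r)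
    (m := μ.parts.filter (2 ≤ ·))).mpr ⟨by
      rw [Fintype.card_fin]
      omega, by
      intro a ha
      exact (Multiset.mem_filter.mp ha).2⟩
  refine ⟨σ, Nat.Partition.ext ?_⟩
  change σ.partition.parts = μ.parts
  rw [Equiv.Perm.parts_partition, ← Equiv.Perm.sum_cycleType, hσ, Fintype.card_fin]
  conv_rhs => rw [hsplit]
  congr 2
  omega

/-- Two partitions `μ`, `θ` of `r` are `p`-equivalent if, for permutations `σ`, `τ` in the
corresponding conjugacy classes, `σ ^ (p ^ s)` and `τ ^ (p ^ s)` are conjugate for some positive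
integer `s`. -/
def PEquivalent (p : ℕ) {r : ℕ} (μ θ : r.Partition) : Prop :=
  ∃ s : ℕ, 0 < s ∧ ∃ σ τ : Equiv.Perm (Fin r),
    cycleShape σ = μ ∧ cycleShape τ = θ ∧ IsConj (σ ^ p ^ s) (τ ^ p ^ s)

theorem isConj_pow_of_le {p r s s' : ℕ} {σ τ : Equiv.Perm (Fin r)} (h : s ≤ s')
    (hc : IsConj (σ ^ p ^ s) (τ ^ p ^ s)) : IsConj (σ ^ p ^ s') (τ ^ p ^ s') := by
  obtain ⟨k, rfl⟩ := Nat.exists_eq_add_of_le h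
  rw [pow_add, pow_mul, pow_mul]
  exact hc.pow _

/-- `p`-equivalence as an equivalence relation on the set of partitions of `r`. -/
def pSetoid (p r : ℕ) : Setoid r.Partition where
  r := PEquivalent p
  iseqv :=
    { refl := fun μ => by
        obtain ⟨σ, hσ⟩ := exists_cycleShape μ
        exact ⟨1, one_pos, σ, σ, hσ, hσ, IsConj.refl _⟩
      symm := by
        rintro μ θ ⟨s, hs, σ, τ, h1, h2, h⟩
        exact ⟨s, hs, τ, σ, h2, h1, h.symm⟩
      trans := by
        rintro μ θ η ⟨s, hs, σ, τ, h1, h2, h⟩ ⟨s', hs', σ', τ', h1', h2', h'⟩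
        have hc : IsConj τ σ' := isConj_iff_cycleShape.mpr (h2.trans h1'.symm)
        refine ⟨s + s', by omega, σ, τ', h1, h2', ?_⟩
        exact ((isConj_pow_of_le (Nat.le_add_right s s') h).trans (hc.pow _)).trans
          (isConj_pow_of_le (Nat.le_add_left s' s) h') }

/-- The set of `p`-equivalence classes of partitions of `r`. -/
abbrev PClass (p r : ℕ) : Type := Quotient (pSetoid p r)

noncomputable instance (p r : ℕ) : DecidableEq (PClass p r) := Classical.decEq _

noncomputable instance (p r : ℕ) : Fintype (PClass p r) :=
  Fintype.ofSurjective (Quotient.mk (pSetoid p r)) Quotient.mk_surjective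

/-- Membership of a partition in a `p`-equivalence class. -/
def MemClass {p r : ℕ} (μ : r.Partition) (J : PClass p r) : Prop :=
  Quotient.mk (pSetoid p r) μ = J

/-- The strict lexicographic order on partitions of `r`, comparing the parts written in
non-increasing order. -/
def LexLT {r : ℕ} (μ θ : r.Partition) : Prop :=
  List.Lex (· < ·) (μ.parts.sort (· ≥ ·)) (θ.parts.sort (· ≥ ·))

end Partitions

/-! ### The descent algebra -/

section Descent

/-- A permutation `π` is increasing on the blocks of the composition `ν` if
`iπ < jπ` whenever `i < j` lie in the same block of consecutive points determined by `ν`;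
that is, the descents of `π` occur only at the partial sums of `ν`. -/
def IncreasingOnBlocks {r : ℕ} (ν : Composition r) (π : Equiv.Perm (Fin r)) : Prop :=
  ∀ i j : Fin r, i < j → ν.index i = ν.index j → π i < π j

instance {r : ℕ} (ν : Composition r) (π : Equiv.Perm (Fin r)) :
    Decidable (IncreasingOnBlocks ν π) := by
  unfold IncreasingOnBlocks
  infer_instance

/-- The element `X^ν` of the group algebra of `Sym(r)` (permutations acting from the right): the
sum of all permutations whose descents occur only at the partial sums of `ν`. -/
noncomputable def descentElt (F : Type*) [Field F] {r : ℕ} (ν : Composition r) :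
    MonoidAlgebra F (Equiv.Perm (Fin r))ᵐᵒᵖ :=
  ∑ π : Equiv.Perm (Fin r) with IncreasingOnBlocks ν π,
    MonoidAlgebra.single (MulOpposite.op π) 1

/-- Solomon's descent algebra `D_{r,F}`: the span of the elements `X^ν`. -/
noncomputable def descentAlgebra (F : Type*) [Field F] (r : ℕ) :
    Submodule F (MonoidAlgebra F (Equiv.Perm (Fin r))ᵐᵒᵖ) :=
  Submodule.span F (Set.range (descentElt F : Composition r → _))

theorem descentElt_apply (F : Type*) [Field F] {r : ℕ} (ν : Composition r)
    (π : Equiv.Perm (Fin r)) :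
    (descentElt F ν).coeff (MulOpposite.op π) = if IncreasingOnBlocks ν π then 1 else 0 := by
  classical
  have h : (descentElt F ν).coeff (MulOpposite.op π) =
      ∑ σ : Equiv.Perm (Fin r) with IncreasingOnBlocks ν σ, if σ = π then (1 : F) else 0 := by
    simp [descentElt, Finsupp.single_apply, Finsupp.finsetSum_apply]
  rw [h, Finset.sum_ite_eq']
  simp

/-- The block structures of two compositions determine each other's partial sums. -/
theorem sizeUpTo_mem_iff {r : ℕ} (ν : Composition r) (k : ℕ) (hk : k + 1 < r) :
    (∃ i ≤ ν.length, ν.sizeUpTo i = k + 1) ↔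
      ν.index ⟨k, by omega⟩ ≠ ν.index ⟨k + 1, hk⟩ := by
  constructor
  · rintro ⟨i, -, h⟩ heq
    have h1 := ν.sizeUpTo_index_le ⟨k, by omega⟩
    have h2 := ν.lt_sizeUpTo_index_succ ⟨k + 1, hk⟩
    rw [← heq] at h2
    simp only [Fin.val_succ] at h1 h2
    have a1 : (ν.index ⟨k, by omega⟩ : ℕ) < i := by
      by_contra! hc
      have := ν.monotone_sizeUpTo hc
      omega
    have a2 := ν.monotone_sizeUpTo (show (ν.index ⟨k, by omega⟩ : ℕ) + 1 ≤ i from a1)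
    omega
  · intro hne
    set m := ν.index ⟨k + 1, hk⟩ with hm
    refine ⟨m, m.2.le, ?_⟩
    have h1 := ν.sizeUpTo_index_le ⟨k + 1, hk⟩
    have h2 := ν.lt_sizeUpTo_index_succ ⟨k + 1, hk⟩
    rw [← hm] at h1 h2
    by_contra hc
    apply hne
    have := (ν.mem_range_embedding_iff (j := ⟨k, by omega⟩) (i := m)).mpr
      ⟨by simp only at h1 ⊢; omega, by simp only [Fin.val_succ, Nat.succ_eq_add_one] at h2 ⊢; omega⟩
    exact (ν.mem_range_embedding_iff'.mp this).symm

theorem composition_eq_of_index {r : ℕ} (ν μ : Composition r)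
    (h : ∀ i j, ν.index i = ν.index j ↔ μ.index i = μ.index j) : ν = μ := by
  apply (compositionEquiv r).injective
  apply CompositionAsSet.ext
  change ν.boundaries = μ.boundaries
  have key : ∀ (c : Composition r) (j : Fin (r + 1)),
      j ∈ c.boundaries ↔ ∃ i ≤ c.length, c.sizeUpTo i = j := by
    intro c j
    simp only [Composition.boundaries, Composition.boundary, Finset.mem_map, Finset.mem_univ,
      true_and, Fin.exists_iff, Fin.ext_iff]
    constructor
    · rintro ⟨i, hi, h⟩
      exact ⟨i, by omega, h⟩
    · rintro ⟨i, hi, h⟩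
      exact ⟨i, by omega, h⟩
  ext ⟨j, hj⟩
  rw [key, key]
  simp only
  rcases j with _ | k
  · exact ⟨fun _ => ⟨0, by omega, by simp⟩, fun _ => ⟨0, by omega, by simp⟩⟩
  · by_cases hk : k + 1 < r
    · rw [sizeUpTo_mem_iff ν k hk, sizeUpTo_mem_iff μ k hk, Ne, Ne, h]
    · have : k + 1 = r := by omega
      exact ⟨fun _ => ⟨μ.length, le_rfl, by simp [this]⟩,
        fun _ => ⟨ν.length, le_rfl, by simp [this]⟩⟩

/-- There is a permutation whose descents are exactly the proper partial sums of `ν`. -/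
theorem exists_exact_descents {r : ℕ} (ν : Composition r) :
    ∃ π : Equiv.Perm (Fin r), ∀ i j : Fin r, i < j → (π i < π j ↔ ν.index i = ν.index j) := by
  let key : Fin r → ℤ := fun i => (i : ℤ) - r * (ν.index i : ℕ)
  have hmono : ∀ i j : Fin r, i < j → ν.index i ≤ ν.index j := by
    intro i j hij
    by_contra! hc
    have h1 := ν.sizeUpTo_index_le i
    have h2 := ν.lt_sizeUpTo_index_succ j
    have h3 := ν.monotone_sizeUpTo (show ((ν.index j : ℕ)).succ ≤ ν.index i from hc)
    simp only [Fin.val_succ] at h2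
    have : (i : ℕ) < j := hij
    simp only [Nat.succ_eq_add_one] at h3
    omega
  have hkey : ∀ i j : Fin r, i < j → (key i < key j ↔ ν.index i = ν.index j) := by
    intro i j hij
    have hij' : (i : ℕ) < j := hij
    rcases (hmono i j hij).eq_or_lt with h | h
    · simp only [h, iff_true, key]
      omega
    · have hlt : (ν.index i : ℕ) + 1 ≤ ν.index j := h
      have hj := j.2
      constructor
      · intro hk
        exfalso
        have : (r : ℤ) * ((ν.index i : ℕ) + 1) ≤ r * (ν.index j : ℕ) := by
          exact_mod_cast Nat.mul_le_mul_left r hlt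
        simp only [key] at hk
        rw [mul_add] at this
        omega
      · intro he
        exact absurd he h.ne
  have hne : ∀ i j : Fin r, i < j → key i ≠ key j := by
    intro i j hij he
    have hij' : (i : ℕ) < j := hij
    rcases (hmono i j hij).eq_or_lt with h | h
    · have := (hkey i j hij).mpr h
      omega
    · have hlt : (ν.index i : ℕ) + 1 ≤ ν.index j := h
      have hj := j.2
      have : (r : ℤ) * ((ν.index i : ℕ) + 1) ≤ r * (ν.index j : ℕ) := by
        exact_mod_cast Nat.mul_le_mul_left r hlt
      simp only [key] at he
      rw [mul_add] at this
      omega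
  have hinj : Function.Injective key := by
    intro i j he
    by_contra hij
    rcases lt_or_gt_of_ne hij with h | h
    · exact hne i j h he
    · exact hne j i h he.symm
  have hs : StrictMono (key ∘ Tuple.sort key) :=
    (Tuple.monotone_sort key).strictMono_of_injective
      (hinj.comp (Tuple.sort key).injective)
  refine ⟨(Tuple.sort key)⁻¹, fun i j hij => ?_⟩
  rw [← hkey i j hij, ← hs.lt_iff_lt]
  simp

theorem descentElt_linearIndependent (F : Type*) [Field F] (r : ℕ) :
    LinearIndependent F (descentElt F : Composition r → _) := by
  classical
  rw [Fintype.linearIndependent_iff]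
  intro a ha
  let N : Composition r → ℕ := fun ν =>
    (Finset.univ.filter fun x : Fin r × Fin r => ν.index x.1 = ν.index x.2).card
  suffices H : ∀ n ν, N ν = n → a ν = 0 from fun ν => H _ ν rfl
  intro n
  induction n using Nat.strong_induction_on with
  | _ n ih =>
    rintro ν rfl
    obtain ⟨π, hπ⟩ := exists_exact_descents ν
    have h1 : ∑ μ : Composition r, a μ * (if IncreasingOnBlocks μ π then 1 else 0) = 0 := by
      have h2 := congrArg (fun x => x.coeff (MulOpposite.op π)) ha
      simp only [← descentElt_apply F]
      simpa [Finsupp.finsetSum_apply] using h2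
    rw [Finset.sum_eq_single ν] at h1
    · have : IncreasingOnBlocks ν π := fun i j hij h => (hπ i j hij).mpr h
      simpa [this] using h1
    · intro μ _ hμ
      by_cases hinc : IncreasingOnBlocks μ π
      · have href : ∀ i j, μ.index i = μ.index j → ν.index i = ν.index j := by
          intro i j h
          rcases lt_trichotomy i j with hij | hij | hij
          · exact (hπ i j hij).mp (hinc i j hij h)
          · rw [hij]
          · exact ((hπ j i hij).mp (hinc j i hij h.symm)).symm
        have hlt : N μ < N ν := by
          apply Finset.card_lt_card
          rw [Finset.ssubset_iff_subset_ne]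
          refine ⟨fun x hx => ?_, fun he => hμ ?_⟩
          · simp only [Finset.mem_filter, Finset.mem_univ, true_and] at hx ⊢
            exact href _ _ hx
          · refine composition_eq_of_index μ ν fun i j => ?_
            have := Finset.ext_iff.mp he (i, j)
            simpa using this
        rw [ih _ hlt μ rfl, zero_mul]
      · simp [hinc]
    · simp

/-- The basis of the descent algebra formed by the elements `X^ν`. -/
noncomputable def descentBasis (F : Type*) [Field F] (r : ℕ) :
    Module.Basis (Composition r) F (descentAlgebra F r) :=
  Module.Basis.span (descentElt_linearIndependent F r)

/-- The Young subgroup `Sym(ν₁) × ⋯ × Sym(ν_k)` of `Sym(r)`. -/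
def youngSubgroup {r : ℕ} (ν : Composition r) : Subgroup (Equiv.Perm (Fin r)) where
  carrier := {σ | ∀ i, ν.index (σ i) = ν.index i}
  one_mem' _ := rfl
  mul_mem' {σ τ} hσ hτ i := (hσ (τ i)).trans (hτ i)
  inv_mem' {σ} hσ i := by
    have := hσ (σ⁻¹ i)
    simpa using this.symm

/-- The Young character `φ^ν`, induced from the trivial character of the Young subgroup: its value
at `σ` is the number of cosets of the Young subgroup fixed by `σ`. -/
noncomputable def youngCharacter {r : ℕ} (ν : Composition r) (σ : Equiv.Perm (Fin r)) : ℕ :=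
  Nat.card (MulAction.fixedBy (Equiv.Perm (Fin r) ⧸ youngSubgroup ν) σ)

/-- Solomon's map `c_{r,F}` from the descent algebra to the class functions of `Sym(r)`, the linear
map with `c_{r,F}(X^ν) = φ^{ν,F}` for all compositions `ν` of `r`. -/
noncomputable def solomonMap (F : Type*) [Field F] (r : ℕ) :
    descentAlgebra F r →ₗ[F] (Equiv.Perm (Fin r) → F) :=
  (descentBasis F r).constr F (fun ν σ => (youngCharacter ν σ : F))

theorem descentElt_mem (F : Type*) [Field F] {r : ℕ} (ν : Composition r) :
    descentElt F ν ∈ descentAlgebra F r :=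
  Submodule.subset_span ⟨ν, rfl⟩

theorem solomonMap_descentElt (F : Type*) [Field F] {r : ℕ} (ν : Composition r)
    (σ : Equiv.Perm (Fin r)) :
    solomonMap F r ⟨descentElt F ν, descentElt_mem F ν⟩ σ = youngCharacter ν σ := by
  have h : (⟨descentElt F ν, descentElt_mem F ν⟩ : descentAlgebra F r) = descentBasis F r ν := by
    exact (Module.Basis.span_apply (descentElt_linearIndependent F r) ν).symm
  rw [h, solomonMap, Module.Basis.constr_basis]

/-- A primitive idempotent of the descent algebra: a non-zero idempotent which is not the sum of
two non-zero orthogonal idempotents of the descent algebra. -/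
def IsPrimitiveDescentIdempotent {F : Type*} [Field F] {r : ℕ}
    (x : MonoidAlgebra F (Equiv.Perm (Fin r))ᵐᵒᵖ) : Prop :=
  x ∈ descentAlgebra F r ∧ IsIdempotentElem x ∧ x ≠ 0 ∧
    ∀ y ∈ descentAlgebra F r, ∀ z ∈ descentAlgebra F r,
      IsIdempotentElem y → IsIdempotentElem z → y * z = 0 → z * y = 0 → x = y + z →
        y = 0 ∨ z = 0

/-- A family `e_J` of pairwise orthogonal primitive idempotents of the descent algebra with sum `1`,
indexed by the `p`-equivalence classes `J` of partitions of `r` in such a way that `c_{r,F}(e_J)`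
takes the value `1` at the conjugacy classes indexed by the partitions in `J` and the value `0` at
all others. -/
structure IsDescentIdempotentFamily {F : Type*} [Field F] {p r : ℕ}
    (e : PClass p r → MonoidAlgebra F (Equiv.Perm (Fin r))ᵐᵒᵖ) : Prop where
  primitive : ∀ J, IsPrimitiveDescentIdempotent (e J)
  complete : CompleteOrthogonalIdempotents e
  map_one : ∀ (J : PClass p r) (σ : Equiv.Perm (Fin r)), MemClass (cycleShape σ) J →
    solomonMap F r ⟨e J, (primitive J).1⟩ σ = 1
  map_zero : ∀ (J : PClass p r) (σ : Equiv.Perm (Fin r)), ¬ MemClass (cycleShape σ) J →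
    solomonMap F r ⟨e J, (primitive J).1⟩ σ = 0

end Descent

end FiltrationTheorem

/-!
The summands `e_J T^r(V)` are independent because the `e_J` are complete orthogonal idempotents, and
they are `G`-stable because place permutations commute with the action of `G`. The filtration comes
from a filtration of `T^r(V)` itself, which does not depend on `J`. For a set `P` of partitions of
`r` that is upward closed in the lexicographic order, let `lexSubmodule F V P` be the span of all
products `a₁ ⋯ a_k` of homogeneous Lie elements whose degrees form a partition in `P`. Exchanging
two neighbouring factors changes such a product by a product in which the two factors are replaced
by their commutator; its degree partition has two parts merged, so it is lexicographically larger
(`sort_lt_sort_merge`). Hence only the multiset of factors matters modulo larger partitions.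

Two facts about this filtration carry the proof.

* *Its factors are the higher Lie modules.* By the Poincaré–Birkhoff–Witt theorem the sorted
  products of the members of a homogeneous basis of the free Lie algebra `L(V)` are linearly
  independent in the tensor algebra. So the product map `higherLieMap` from `L^μ(V)` is injective
  modulo `P = {θ | μ < θ}` and reaches all products with degree partition `μ`
  (`eq_zero_of_higherLieMap_mem`, `exists_sub_higherLieMap_mem`). The linear independence is
  `linearIndependent_sorted_prod`: `L` acts on the span of the multisets of basis elements in such
  a way that a sorted product maps the empty multiset to the multiset of its factors, and the action
  extends to the tensor algebra, which is free on `V` (`tensorAction`). The spanning part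
  needs no more than the reordering of products.

* *The descent algebra acts on the factors through Solomon's map.* Inside the tensor algebra, `X^ν`
  acts as the convolution product of the projections to the homogeneous components of degrees
  `ν₁, ν₂, …`, formed with the cocommutative coproduct for which `V` is primitive
  (`toTensorAlgebra_descentElt`). Lie elements are primitive, so `X^ν` maps `a₁ ⋯ a_k` to the sum,
  over all distributions of the `k` factors to the blocks of `ν` which fill each block exactly, of
  the product of the factors sorted by blocks (`convolution_prod`). Each summand is congruent to
  `a₁ ⋯ a_k` modulo larger partitions, and the number of summands is the number of cosets of the
  Young subgroup fixed by a permutation `σ` whose cycle lengths are the degrees of the `a_i`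
  (`youngCharacter_eq_card`). So an element `x` of the descent algebra acts on the factor of `μ` as
  the scalar `c_{r,F}(x)(σ)` (`placeRep_sub_solomonMap_smul_mem`).

Consequently `e_J` acts as `1` on the factors that belong to the partitions in `J` and as `0` on all
others, and intersecting `e_J T^r(V)` with the filtration of `T^r(V)` gives a filtration whose
factors are the `L^μ(V)` with `μ` in `J`: the steps where `e_J` acts as `0` collapse
(`placeImage_inf_lexSubrep_eq`), and the others are retained (`nonempty_factorRep_equiv_higherLie`).
-/

namespace FiltrationTheorem

attribute [local instance] LieRing.ofAssociativeRing

/-! ### The Poincaré–Birkhoff–Witt representation -/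

section PBW

/-- Induction on the expansion of an element in a basis. -/
@[elab_as_elim]
theorem basis_induction {F M B : Type*} [Field F] [AddCommMonoid M] [Module F M]
    (b : Module.Basis B F M) {motive : M → Prop} (zero : motive 0)
    (add : ∀ x y, motive x → motive y → motive (x + y))
    (smul : ∀ (c : F) x, motive x → motive (c • x)) (basis : ∀ i, motive (b i)) (x : M) :
    motive x := by
  induction b.mem_span x using Submodule.span_induction with
  | zero => exact zero
  | add x y _ _ hx hy => exact add x y hx hy
  | smul c x _ hx => exact smul c x hx
  | mem x hx =>
    obtain ⟨i, rfl⟩ := hx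
    exact basis i

variable {F L B : Type*} [Field F] [LieRing L] [LieAlgebra F L]
  (b : Module.Basis B F L)

/-- The bilinear extension of an operation of basis elements of `L` on monomials, where the
monomials in the basis elements are represented by multisets. -/
noncomputable def bilinearExtension (a : B → Multiset B → (Multiset B →₀ F)) :
    L →ₗ[F] (Multiset B →₀ F) →ₗ[F] (Multiset B →₀ F) :=
  b.constr F fun i => Finsupp.linearCombination F (a i)

theorem bilinearExtension_basis (a : B → Multiset B → (Multiset B →₀ F)) (i : B)
    (S : Multiset B) :
    bilinearExtension b a (b i) (Finsupp.single S 1) = a i S := by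
  simp [bilinearExtension, Module.Basis.constr_basis]

variable (B F) in
/-- The span of the monomials of degree at most `n`. -/
noncomputable def degreeLE (n : ℕ) : Submodule F (Multiset B →₀ F) :=
  Submodule.span F ((fun S => Finsupp.single S 1) '' {S : Multiset B | S.card ≤ n})

theorem single_mem_degreeLE {S : Multiset B} {n : ℕ} (h : S.card ≤ n) :
    Finsupp.single S (1 : F) ∈ degreeLE F B n :=
  Submodule.subset_span ⟨S, h, rfl⟩

theorem degreeLE_mono {m n : ℕ} (h : m ≤ n) : degreeLE F B m ≤ degreeLE F B n :=
  Submodule.span_mono (Set.image_mono fun _ hS => le_trans hS h)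

theorem exists_mem_degreeLE (m : Multiset B →₀ F) : ∃ n, m ∈ degreeLE F B n := by
  induction m using Finsupp.induction_linear with
  | zero => exact ⟨0, zero_mem _⟩
  | add x y hx hy =>
    obtain ⟨n, hn⟩ := hx
    obtain ⟨k, hk⟩ := hy
    exact ⟨max n k, add_mem (degreeLE_mono (le_max_left _ _) hn)
      (degreeLE_mono (le_max_right _ _) hk)⟩
  | single S c =>
    refine ⟨S.card, ?_⟩
    rw [← mul_one c, ← smul_eq_mul, ← Finsupp.smul_single]
    exact Submodule.smul_mem _ _ (single_mem_degreeLE le_rfl)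

theorem bilinearExtension_mem {a : B → Multiset B → (Multiset B →₀ F)} {n : ℕ}
    (ha : ∀ i S, S.card ≤ n → a i S ∈ degreeLE F B (S.card + 1)) {k : ℕ} (hk : k ≤ n) (x : L)
    {m : Multiset B →₀ F} (hm : m ∈ degreeLE F B k) :
    bilinearExtension b a x m ∈ degreeLE F B (k + 1) := by
  induction hm using Submodule.span_induction with
  | zero => simp
  | add m m' _ _ h h' => rw [map_add]; exact add_mem h h'
  | smul c m _ h => rw [map_smul]; exact Submodule.smul_mem _ _ h
  | mem m hm =>
    obtain ⟨S, hS, rfl⟩ := hm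
    induction x using basis_induction b with
    | zero => simp
    | add x y hx hy => rw [map_add, LinearMap.add_apply]; exact add_mem hx hy
    | smul c x hx => rw [map_smul, LinearMap.smul_apply]; exact Submodule.smul_mem _ _ hx
    | basis i =>
      simp only [bilinearExtension_basis]
      have hS' : S.card ≤ k := hS
      exact degreeLE_mono (by omega) (ha i S (hS'.trans hk))

theorem bilinearExtension_congr {a a' : B → Multiset B → (Multiset B →₀ F)} {n : ℕ}
    (ha : ∀ i S, S.card ≤ n → a i S = a' i S) (x : L)
    {m : Multiset B →₀ F} (hm : m ∈ degreeLE F B n) :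
    bilinearExtension b a x m = bilinearExtension b a' x m := by
  induction hm using Submodule.span_induction with
  | zero => simp
  | add m m' _ _ h h' => rw [map_add, map_add, h, h']
  | smul c m _ h => rw [map_smul, map_smul, h]
  | mem m hm =>
    obtain ⟨S, hS, rfl⟩ := hm
    induction x using basis_induction b with
    | zero => simp
    | add x y hx hy => simp only [map_add, LinearMap.add_apply, hx, hy]
    | smul c x hx => simp only [map_smul, LinearMap.smul_apply, hx]
    | basis i =>
      simp only [bilinearExtension_basis]
      exact ha i S hS

theorem mem_degreeLE_of_sub_single {x : Multiset B →₀ F} {i : B} {S : Multiset B}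
    (h : x - Finsupp.single (i ::ₘ S) 1 ∈ degreeLE F B S.card) :
    x ∈ degreeLE F B (S.card + 1) := by
  rw [← sub_add_cancel x (Finsupp.single (i ::ₘ S) 1)]
  exact add_mem (degreeLE_mono (Nat.le_succ _) h) (single_mem_degreeLE (by simp))

variable [LinearOrder B]

/-- The action of a basis element on a monomial, defined by recursion on a bound `n` for the
degree of the monomial; the values at monomials of degree above `n` are irrelevant. If `j` is the
least factor of the monomial `z_S = z_j z_{S'}` and `j < i`, then `x_i z_S` has to be
`x_j x_i z_{S'} + [x_i, x_j] z_{S'}`, where `x_j` is applied to the leading term `z_i z_{S'}` of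
`x_i z_{S'}` by multiplication with `z_j`. -/
noncomputable def straighten : ℕ → B → Multiset B → (Multiset B →₀ F)
  | 0, i, S => Finsupp.single (i ::ₘ S) 1
  | n + 1, i, S =>
    open Classical in
    if h : ∃ j ∈ S, (∀ k ∈ S, j ≤ k) ∧ j < i then
      Finsupp.single (i ::ₘ S) 1 +
        bilinearExtension b (straighten n) (b h.choose)
          (straighten n i (S.erase h.choose) - Finsupp.single (i ::ₘ S.erase h.choose) 1) +
        bilinearExtension b (straighten n) ⁅b i, b h.choose⁆
          (Finsupp.single (S.erase h.choose) 1)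
    else Finsupp.single (i ::ₘ S) 1

theorem straighten_of_le (n : ℕ) {i : B} {S : Multiset B} (h : ∀ j ∈ S, i ≤ j) :
    straighten b n i S = Finsupp.single (i ::ₘ S) 1 := by
  cases n with
  | zero => rfl
  | succ n =>
    rw [straighten, dif_neg]
    rintro ⟨j, hj, -, hlt⟩
    exact absurd (h j hj) (not_le.mpr hlt)

theorem straighten_cons (n : ℕ) {i j : B} {S : Multiset B} (h : ∀ k ∈ S, j ≤ k) (hij : j < i) :
    straighten b (n + 1) i (j ::ₘ S) = Finsupp.single (i ::ₘ j ::ₘ S) 1 +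
        bilinearExtension b (straighten b n) (b j)
          (straighten b n i S - Finsupp.single (i ::ₘ S) 1) +
        bilinearExtension b (straighten b n) ⁅b i, b j⁆ (Finsupp.single S 1) := by
  have hex : ∃ k ∈ j ::ₘ S, (∀ l ∈ j ::ₘ S, k ≤ l) ∧ k < i :=
    ⟨j, Multiset.mem_cons_self _ _, by simpa using h, hij⟩
  have hj : hex.choose = j := by
    obtain ⟨h1, h2, -⟩ := hex.choose_spec
    refine le_antisymm (h2 j (Multiset.mem_cons_self _ _)) ?_
    rcases Multiset.mem_cons.mp h1 with h1 | h1
    · exact h1.ge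
    · exact h _ h1
  rw [straighten, dif_pos hex, hj, Multiset.erase_cons_head]

/-- A monomial either has only factors `≥ i`, or its least factor is `< i`. -/
theorem forall_le_or_exists_cons (i : B) (S : Multiset B) :
    (∀ j ∈ S, i ≤ j) ∨ ∃ j S', S = j ::ₘ S' ∧ (∀ k ∈ S', j ≤ k) ∧ j < i := by
  by_cases h : ∀ j ∈ S, i ≤ j
  · exact Or.inl h
  · right
    push Not at h
    obtain ⟨k, hk, hki⟩ := h
    have hne : S.toFinset.Nonempty := ⟨k, by simpa using hk⟩
    have hmem : S.toFinset.min' hne ∈ S := by simpa using S.toFinset.min'_mem hne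
    refine ⟨S.toFinset.min' hne, S.erase (S.toFinset.min' hne), (Multiset.cons_erase hmem).symm,
      fun l hl => S.toFinset.min'_le l (by simpa using Multiset.mem_of_mem_erase hl), ?_⟩
    exact (S.toFinset.min'_le k (by simpa using hk)).trans_lt hki

theorem straighten_sub_single_mem (n : ℕ) (i : B) (S : Multiset B) (hS : S.card ≤ n) :
    straighten b n i S - Finsupp.single (i ::ₘ S) 1 ∈ degreeLE F B S.card := by
  induction n generalizing i S with
  | zero => simp [straighten]
  | succ n ih =>
    rcases forall_le_or_exists_cons i S with h | ⟨j, S', rfl, h, hlt⟩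
    · simp [straighten_of_le b _ h]
    · rw [straighten_cons b n h hlt, add_assoc, add_sub_cancel_left]
      rw [Multiset.card_cons] at hS ⊢
      have hb := fun i S hS => mem_degreeLE_of_sub_single (ih i S hS)
      exact add_mem (bilinearExtension_mem b hb (by omega) _ (ih i S' (by omega)))
        (bilinearExtension_mem b hb (by omega) _ (single_mem_degreeLE le_rfl))

theorem straighten_succ (n : ℕ) (i : B) (S : Multiset B) (hS : S.card ≤ n) :
    straighten b (n + 1) i S = straighten b n i S := by
  induction n generalizing i S with
  | zero =>
    obtain rfl : S = 0 := Multiset.card_eq_zero.mp (Nat.le_zero.mp hS)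
    rw [straighten_of_le b _ (by simp), straighten_of_le b _ (by simp)]
  | succ n ih =>
    rcases forall_le_or_exists_cons i S with h | ⟨j, S', rfl, h, hlt⟩
    · rw [straighten_of_le b _ h, straighten_of_le b _ h]
    · rw [Multiset.card_cons] at hS
      have h1 : S'.card ≤ n := by omega
      rw [straighten_cons b _ h hlt, straighten_cons b _ h hlt, ih i S' h1,
        bilinearExtension_congr b ih _
          (degreeLE_mono h1 (straighten_sub_single_mem b n i S' h1)),
        bilinearExtension_congr b ih _ (single_mem_degreeLE h1)]

theorem straighten_eq_of_card_le {n : ℕ} (i : B) {S : Multiset B} (hS : S.card ≤ n) :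
    straighten b n i S = straighten b S.card i S := by
  induction n, hS using Nat.le_induction with
  | base => rfl
  | succ n hn ih => rw [straighten_succ b n i S hn, ih]

/-- The action of the Lie algebra `L` on the polynomials in its basis elements. -/
noncomputable def pbwAction : L →ₗ[F] (Multiset B →₀ F) →ₗ[F] (Multiset B →₀ F) :=
  bilinearExtension b fun i S => straighten b S.card i S

theorem pbwAction_eq {n : ℕ} (x : L) {m : Multiset B →₀ F} (hm : m ∈ degreeLE F B n) :
    pbwAction b x m = bilinearExtension b (straighten b n) x m :=
  bilinearExtension_congr b (fun i _ hS => (straighten_eq_of_card_le b i hS).symm) x hm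

theorem pbwAction_single_of_le {i : B} {S : Multiset B} (h : ∀ j ∈ S, i ≤ j) :
    pbwAction b (b i) (Finsupp.single S 1) = Finsupp.single (i ::ₘ S) 1 := by
  rw [pbwAction, bilinearExtension_basis, straighten_of_le b _ h]

theorem pbwAction_sub_single_mem (i : B) (S : Multiset B) :
    pbwAction b (b i) (Finsupp.single S 1) - Finsupp.single (i ::ₘ S) 1 ∈
      degreeLE F B S.card := by
  rw [pbwAction, bilinearExtension_basis]
  exact straighten_sub_single_mem b _ i S le_rfl

theorem pbwAction_cons {i j : B} {S : Multiset B} (h : ∀ k ∈ S, j ≤ k) (hij : j < i) :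
    pbwAction b (b i) (Finsupp.single (j ::ₘ S) 1) =
      pbwAction b (b j) (pbwAction b (b i) (Finsupp.single S 1)) +
        pbwAction b ⁅b i, b j⁆ (Finsupp.single S 1) := by
  have hj : ∀ k ∈ i ::ₘ S, j ≤ k := by simpa using ⟨hij.le, h⟩
  have h1 : pbwAction b (b j) (pbwAction b (b i) (Finsupp.single S 1)) =
      Finsupp.single (i ::ₘ j ::ₘ S) 1 + pbwAction b (b j)
        (pbwAction b (b i) (Finsupp.single S 1) - Finsupp.single (i ::ₘ S) 1) := by
    rw [map_sub, pbwAction_single_of_le b hj, Multiset.cons_swap, add_sub_cancel]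
  rw [h1, pbwAction_eq b _ (pbwAction_sub_single_mem b i S),
    pbwAction_eq b ⁅b i, b j⁆ (single_mem_degreeLE (le_refl S.card))]
  simp only [pbwAction, bilinearExtension_basis]
  rw [Multiset.card_cons, straighten_cons b _ h hij]

/-- The case of the commutation relation in which one of the two basis elements is at most every
factor of the monomial. -/
theorem pbwAction_comm_of_le {i j : B} {S : Multiset B} (h : ∀ k ∈ S, j ≤ k) (hij : j < i) :
    pbwAction b (b i) (pbwAction b (b j) (Finsupp.single S 1)) =
      pbwAction b (b j) (pbwAction b (b i) (Finsupp.single S 1)) +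
        pbwAction b ⁅b i, b j⁆ (Finsupp.single S 1) := by
  rw [pbwAction_single_of_le b h, pbwAction_cons b h hij]

/-- The commutation relation at a monomial, reduced to pairs of basis elements `b i`, `b j` with
`j < i` by bilinearity and antisymmetry. -/
theorem pbwAction_comm_of_basis {m : Multiset B →₀ F}
    (h : ∀ i j, j < i → pbwAction b (b i) (pbwAction b (b j) m) =
      pbwAction b (b j) (pbwAction b (b i) m) + pbwAction b ⁅b i, b j⁆ m) (x y : L) :
    pbwAction b x (pbwAction b y m) =
      pbwAction b y (pbwAction b x m) + pbwAction b ⁅x, y⁆ m := by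
  induction x using basis_induction b with
  | zero => simp
  | add x x' hx hx' => simp only [map_add, add_lie, LinearMap.add_apply, hx, hx']; abel
  | smul c x hx => simp only [map_smul, smul_lie, LinearMap.smul_apply, hx, smul_add]
  | basis i =>
    induction y using basis_induction b with
    | zero => simp
    | add y y' hy hy' => simp only [map_add, lie_add, LinearMap.add_apply, hy, hy']; abel
    | smul c y hy => simp only [map_smul, lie_smul, LinearMap.smul_apply, hy, smul_add]
    | basis j =>
      rcases lt_trichotomy i j with hij | rfl | hij
      · rw [h j i hij, ← lie_skew, map_neg, LinearMap.neg_apply]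
        abel
      · simp
      · exact h i j hij

theorem pbwAction_comm (x y : L) (m : Multiset B →₀ F) :
    pbwAction b x (pbwAction b y m) =
      pbwAction b y (pbwAction b x m) + pbwAction b ⁅x, y⁆ m := by
  suffices H : ∀ n, ∀ m ∈ degreeLE F B n, ∀ x y : L, pbwAction b x (pbwAction b y m) =
      pbwAction b y (pbwAction b x m) + pbwAction b ⁅x, y⁆ m by
    obtain ⟨n, hn⟩ := exists_mem_degreeLE m
    exact H n m hn x y
  intro n
  induction n using Nat.strong_induction_on with
  | _ n ih =>
  intro m hm
  induction hm using Submodule.span_induction with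
  | zero => simp
  | add m m' _ _ h h' => intro x y; simp only [map_add, h x y, h' x y]; abel
  | smul c m _ h => intro x y; simp only [map_smul, h x y, smul_add]
  | mem m hm =>
    obtain ⟨S, hS, rfl⟩ := hm
    refine fun x y => pbwAction_comm_of_basis b (fun i j hij => ?_) x y
    dsimp only
    rcases forall_le_or_exists_cons j S with h | ⟨k, S', rfl, h, hkj⟩
    · exact pbwAction_comm_of_le b h hij
    · have hS' : S'.card < n := by
        have : (k ::ₘ S').card ≤ n := hS
        rw [Multiset.card_cons] at this
        omega
      have ih' := ih _ hS' _ (single_mem_degreeLE (F := F) (le_refl S'.card))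
      -- Commuting `x_i` past `x_k` on `x_j z_{S'}`: the leading term is covered by the minimality
      -- of `k`, the remainder by the induction hypothesis.
      have key : ∀ i j, k < i → k < j →
          pbwAction b (b i) (pbwAction b (b k) (pbwAction b (b j) (Finsupp.single S' 1))) =
            pbwAction b (b k) (pbwAction b (b i) (pbwAction b (b j) (Finsupp.single S' 1))) +
              pbwAction b ⁅b i, b k⁆ (pbwAction b (b j) (Finsupp.single S' 1)) := by
        intro i j hki hkj
        have e : pbwAction b (b j) (Finsupp.single S' 1) = Finsupp.single (j ::ₘ S') 1 +
            (pbwAction b (b j) (Finsupp.single S' 1) - Finsupp.single (j ::ₘ S') 1) := by abel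
        have h1 := pbwAction_comm_of_le b (S := j ::ₘ S') (by simpa using ⟨hkj.le, h⟩) hki
        have h2 := ih _ hS' _ (pbwAction_sub_single_mem b j S') (b i) (b k)
        rw [e]
        simp only [map_add, h1, h2]
        abel
      have hzk : Finsupp.single (k ::ₘ S') (1 : F) =
          pbwAction b (b k) (Finsupp.single S' 1) := (pbwAction_single_of_le b h).symm
      have hki := hkj.trans hij
      have expand : ∀ i j, k < i → k < j →
          pbwAction b (b i) (pbwAction b (b j) (pbwAction b (b k) (Finsupp.single S' 1))) =
            pbwAction b (b k) (pbwAction b (b i) (pbwAction b (b j) (Finsupp.single S' 1))) +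
              pbwAction b ⁅b i, b k⁆ (pbwAction b (b j) (Finsupp.single S' 1)) +
              (pbwAction b ⁅b j, b k⁆ (pbwAction b (b i) (Finsupp.single S' 1)) +
                pbwAction b ⁅b i, ⁅b j, b k⁆⁆ (Finsupp.single S' 1)) := by
        intro i j hki hkj
        rw [ih' (b j) (b k), map_add, key i j hki hkj, ih' (b i) ⁅b j, b k⁆]
      have hjac : ⁅⁅b i, b j⁆, b k⁆ = ⁅b i, ⁅b j, b k⁆⁆ - ⁅b j, ⁅b i, b k⁆⁆ := lie_lie _ _ _
      rw [hzk, expand i j hki hkj, expand j i hkj hki, ih' ⁅b i, b j⁆ (b k), hjac,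
        ih' (b i) (b j), map_add]
      simp only [map_sub, LinearMap.sub_apply]
      abel

/-- The Poincaré–Birkhoff–Witt representation of `L` on the polynomials in its basis elements. -/
noncomputable def pbwRep : L →ₗ⁅F⁆ Module.End F (Multiset B →₀ F) where
  __ := pbwAction b
  map_lie' {x y} := by
    refine LinearMap.ext fun m => ?_
    change pbwAction b ⁅x, y⁆ m = pbwAction b x (pbwAction b y m) - pbwAction b y (pbwAction b x m)
    rw [pbwAction_comm b x y, add_sub_cancel_left]

/-- A sorted product of basis elements, applied to the monomial `1`, gives the monomial with the
same factors. -/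
theorem pbwRep_prod_sorted {l : List B} (hl : l.Pairwise (· ≤ ·)) :
    (l.map fun i => pbwRep b (b i)).prod (Finsupp.single 0 1) =
      Finsupp.single (l : Multiset B) 1 := by
  induction l with
  | nil => simp
  | cons i l ih =>
    rw [List.pairwise_cons] at hl
    rw [List.map_cons, List.prod_cons, Module.End.mul_apply, ih hl.2]
    exact pbwAction_single_of_le b (S := (l : Multiset B)) (by simpa using hl.1)

/-- The Poincaré–Birkhoff–Witt theorem for a Lie algebra `L` mapped to an associative algebra `A`,
provided that the Lie algebra homomorphisms from `L` to the endomorphisms of the polynomials in the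
basis elements extend to `A`: the sorted products of basis elements are linearly independent. -/
theorem linearIndependent_sorted_prod {A : Type*} [Ring A] [Algebra F A] (ι : L → A)
    (ψ : A →ₐ[F] Module.End F (Multiset B →₀ F)) (hψ : ∀ x, ψ (ι x) = pbwRep b x) :
    LinearIndependent F fun S : Multiset B => ((S.sort (· ≤ ·)).map fun i => ι (b i)).prod := by
  refine LinearIndependent.of_comp
    (LinearMap.applyₗ (Finsupp.single (0 : Multiset B) (1 : F)) ∘ₗ ψ.toLinearMap) ?_
  have h : (fun S : Multiset B => (Finsupp.single S 1 : Multiset B →₀ F)) =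
      (LinearMap.applyₗ (Finsupp.single (0 : Multiset B) (1 : F)) ∘ₗ ψ.toLinearMap) ∘
        fun S : Multiset B => ((S.sort (· ≤ ·)).map fun i => ι (b i)).prod := by
    funext S
    simp only [Function.comp_apply, LinearMap.comp_apply, AlgHom.toLinearMap_apply,
      LinearMap.applyₗ_apply_apply, map_list_prod, List.map_map, Function.comp_def, hψ]
    rw [pbwRep_prod_sorted b (S.pairwise_sort _), Multiset.sort_eq]
  rw [← h]
  exact Finsupp.linearIndependent_single_one F (Multiset B)

end PBW

/-! ### Stable sorting of products -/

section Sorting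

theorem prod_map_ite_one {ι M : Type*} [Monoid M] (p : ι → Prop) [DecidablePred p] (x : ι → M)
    (l : List ι) :
    (l.map fun i => if p i then x i else 1).prod = ((l.filter fun i => p i).map x).prod := by
  induction l with
  | nil => simp
  | cons i l ih => by_cases h : p i <;> simp [h, ih]

theorem ofFn_sort_eq_flatMap {m k : ℕ} (f : Fin m → Fin k) :
    List.ofFn (Tuple.sort f) =
      (List.finRange k).flatMap fun j => (List.finRange m).filter fun i => f i = j := by
  have h1 : (List.ofFn (Tuple.sort f)).Pairwise fun a b => f a < f b ∨ (f a = f b ∧ a < b) := by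
    rw [List.pairwise_ofFn]
    intro i j hij
    obtain ⟨hm, hs⟩ := (Tuple.eq_sort_iff (σ := Tuple.sort f) (f := f)).mp rfl
    rcases (hm hij.le).lt_or_eq with h | h
    · exact Or.inl h
    · exact Or.inr ⟨h, hs i j hij h⟩
  have h2 : ((List.finRange k).flatMap fun j => (List.finRange m).filter fun i => f i = j).Pairwise
      fun a b => f a < f b ∨ (f a = f b ∧ a < b) := by
    rw [List.pairwise_flatMap]
    constructor
    · intro j _
      rw [List.pairwise_filter]
      refine (List.pairwise_lt_finRange m).imp fun {a b} hab ha hb => Or.inr ⟨?_, hab⟩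
      simp only [decide_eq_true_eq] at ha hb
      rw [ha, hb]
    · refine (List.pairwise_lt_finRange k).imp fun {a b} hab x hx y hy => Or.inl ?_
      simp only [List.mem_filter, decide_eq_true_eq] at hx hy
      rw [hx.2, hy.2]
      exact hab
  have hirr : ∀ a b : Fin m, (f a < f b ∨ (f a = f b ∧ a < b)) → a ≠ b := by
    rintro a b h rfl
    simp at h
  refine List.Perm.eq_of_pairwise ?_ h1 h2 ?_
  · intro a b _ _ hab hba
    rcases hab with hab | hab <;> rcases hba with hba | hba
    · exact absurd hba hab.not_gt
    · exact absurd hba.1.symm hab.ne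
    · exact absurd hab.1.symm hba.ne
    · exact absurd hba.2 hab.2.not_gt
  · rw [List.perm_ext_iff_of_nodup (h1.imp fun h => hirr _ _ h) (h2.imp fun h => hirr _ _ h)]
    intro a
    simp only [List.mem_ofFn, List.mem_flatMap, List.mem_finRange, List.mem_filter, true_and,
      decide_eq_true_eq, exists_eq', iff_true]
    exact (Tuple.sort f).surjective a

/-- Collecting the factors of a product according to the values of `f` amounts to sorting them
stably with respect to `f`. -/
theorem prod_fibers_eq_prod_sort {M : Type*} [Monoid M] {m k : ℕ} (f : Fin m → Fin k)
    (x : Fin m → M) :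
    (List.ofFn fun j => (List.ofFn fun i => if f i = j then x i else 1).prod).prod =
      (List.ofFn (x ∘ Tuple.sort f)).prod := by
  rw [← List.map_ofFn, ofFn_sort_eq_flatMap, List.map_flatMap, List.flatMap_def, List.prod_flatten,
    List.map_map, List.ofFn_eq_map]
  congr 2
  funext j
  rw [List.ofFn_eq_map, prod_map_ite_one fun i => f i = j]
  rfl

end Sorting

/-! ### Coproducts of products of Lie elements -/

section Coproduct

variable {F V : Type*} [Field F] [AddCommGroup V] [Module F V]

variable (F V) in
/-- The homogeneous component of degree `i` of the tensor algebra. -/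
noncomputable abbrev component (i : ℕ) : Submodule F (TensorAlgebra F V) :=
  LinearMap.range (TensorAlgebra.ι F : V →ₗ[F] TensorAlgebra F V) ^ i

variable (F V) in
/-- The `k`-fold coproduct of the tensor algebra for which the elements of `V` are primitive. -/
noncomputable def coproduct (k : ℕ) :
    TensorAlgebra F V →ₐ[F] ⨂[F] _ : Fin k, TensorAlgebra F V :=
  TensorAlgebra.lift F
    (∑ j : Fin k, (PiTensorProduct.singleAlgHom (R := F) j).toLinearMap ∘ₗ TensorAlgebra.ι F)

/-- Lie elements are primitive. -/
theorem coproduct_of_mem_freeLie (k : ℕ) {x : TensorAlgebra F V} (hx : x ∈ freeLie F V) :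
    coproduct F V k x = ∑ j : Fin k, PiTensorProduct.singleAlgHom (R := F) j x := by
  unfold freeLie at hx
  induction hx using LieSubalgebra.lieSpan_induction with
  | mem x h =>
    obtain ⟨v, rfl⟩ := h
    simp only [coproduct, TensorAlgebra.lift_ι_apply, LinearMap.sum_apply, LinearMap.comp_apply,
      AlgHom.toLinearMap_apply]
  | zero => simp only [map_zero, Finset.sum_const_zero]
  | add x y _ _ hx hy => simp only [map_add, hx, hy, Finset.sum_add_distrib]
  | smul a x _ hx => simp only [map_smul, hx, Finset.smul_sum]
  | lie x y _ _ hx hy =>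
    have hcomm : ∀ i j : Fin k, i ≠ j →
        PiTensorProduct.singleAlgHom (R := F) (A := fun _ => TensorAlgebra F V) i x *
            PiTensorProduct.singleAlgHom (R := F) j y =
          PiTensorProduct.singleAlgHom (R := F) j y *
            PiTensorProduct.singleAlgHom (R := F) i x := by
      intro i j hij
      exact Commute.tprod
        (Pi.mulSingle_commute (f := fun _ : Fin k => TensorAlgebra F V) hij x y)
    simp only [LieRing.of_associative_ring_bracket, map_sub, map_mul, hx, hy,
      Finset.sum_sub_distrib]
    rw [Finset.sum_mul_sum, Finset.sum_mul_sum, Finset.sum_comm (s := Finset.univ (α := Fin k)),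
      ← Finset.sum_sub_distrib, ← Finset.sum_sub_distrib]
    refine Finset.sum_congr rfl fun i _ => ?_
    rw [← Finset.sum_sub_distrib, Finset.sum_eq_single i]
    · intro j _ hji
      rw [hcomm j i hji, sub_self]
    · simp

theorem coproduct_prod (k : ℕ) {m : ℕ} (x : Fin m → TensorAlgebra F V)
    (hx : ∀ i, x i ∈ freeLie F V) :
    coproduct F V k (List.ofFn x).prod = ∑ f : Fin m → Fin k,
      PiTensorProduct.tprod F fun j => (List.ofFn fun i => if f i = j then x i else 1).prod := by
  rw [map_list_prod, List.map_ofFn]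
  have h : (coproduct F V k : TensorAlgebra F V → _) ∘ x =
      fun i => ∑ j : Fin k, PiTensorProduct.singleAlgHom (R := F) j (x i) :=
    funext fun i => coproduct_of_mem_freeLie k (hx i)
  rw [h, ← MultilinearMap.mkPiAlgebraFin_apply (R := F), MultilinearMap.map_sum]
  refine Finset.sum_congr rfl fun f _ => ?_
  have h2 : (fun i => PiTensorProduct.singleAlgHom (R := F) (A := fun _ => TensorAlgebra F V)
      (f i) (x i)) =
      (PiTensorProduct.tprodMonoidHom F : (Fin k → TensorAlgebra F V) →* _) ∘
        fun i => Pi.mulSingle (f i) (x i) := rfl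
  rw [MultilinearMap.mkPiAlgebraFin_apply, h2, ← List.map_ofFn, ← map_list_prod]
  change PiTensorProduct.tprod F _ = _
  congr 1
  funext j
  refine (map_list_prod (Pi.evalMonoidHom (fun _ : Fin k => TensorAlgebra F V) j) _).trans ?_
  rw [List.map_ofFn]
  congr 2
  funext i
  simp [Pi.mulSingle_apply, eq_comm]

/-- The map `x₁ ⊗ ⋯ ⊗ x_k ↦ p_{ν₁}(x₁) ⋯ p_{ν_k}(x_k)`, where `p_i` is the projection to the
homogeneous component of degree `i`. -/
noncomputable def mulComponents (V : Type*) [AddCommGroup V] [Module F V] {r : ℕ}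
    (ν : Composition r) : (⨂[F] _ : Fin ν.length, TensorAlgebra F V) →ₗ[F] TensorAlgebra F V :=
  PiTensorProduct.lift
    ((MultilinearMap.mkPiAlgebraFin F ν.length (TensorAlgebra F V)).compLinearMap
      fun j => GradedAlgebra.proj (component F V) (ν.blocksFun j))

variable (F V) in
/-- The convolution product `p_{ν₁} * ⋯ * p_{ν_k}` of projections to homogeneous components. -/
noncomputable def convolution {r : ℕ} (ν : Composition r) :
    TensorAlgebra F V →ₗ[F] TensorAlgebra F V :=
  mulComponents V ν ∘ₗ (coproduct F V ν.length).toLinearMap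

/-- The maps `f` for which the degrees `d i` of the factors mapped to `j` sum up to `ν_j`. -/
def contentMaps {m r : ℕ} (ν : Composition r) (d : Fin m → ℕ) : Finset (Fin m → Fin ν.length) :=
  Finset.univ.filter fun f => ∀ j, ∑ i with f i = j, d i = ν.blocksFun j

theorem prod_fiber_mem_component {m k : ℕ} (f : Fin m → Fin k) (x : Fin m → TensorAlgebra F V)
    (d : Fin m → ℕ) (hd : ∀ i, x i ∈ component F V (d i)) (j : Fin k) :
    (List.ofFn fun i => if f i = j then x i else 1).prod ∈
      component F V (∑ i with f i = j, d i) := by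
  rw [Finset.sum_filter, ← List.sum_ofFn]
  refine SetLike.list_prod_ofFn_mem_graded (A := component F V) _ _ fun i => ?_
  split_ifs
  · exact hd i
  · exact SetLike.GradedOne.one_mem

theorem convolution_prod {r m : ℕ} (ν : Composition r) (x : Fin m → TensorAlgebra F V)
    (hx : ∀ i, x i ∈ freeLie F V) (d : Fin m → ℕ) (hd : ∀ i, x i ∈ component F V (d i)) :
    convolution F V ν (List.ofFn x).prod =
      ∑ f ∈ contentMaps ν d, (List.ofFn (x ∘ Tuple.sort f)).prod := by
  rw [convolution, LinearMap.comp_apply, AlgHom.toLinearMap_apply, coproduct_prod _ x hx, map_sum,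
    contentMaps, Finset.sum_filter]
  refine Finset.sum_congr rfl fun f _ => ?_
  rw [mulComponents, PiTensorProduct.lift.tprod, MultilinearMap.compLinearMap_apply,
    MultilinearMap.mkPiAlgebraFin_apply]
  split_ifs with h
  · rw [← prod_fibers_eq_prod_sort]
    congr 2
    funext j
    rw [GradedAlgebra.proj_apply]
    refine DirectSum.decompose_of_mem_same _ ?_
    rw [← h j]
    exact prod_fiber_mem_component f x d hd j
  · push Not at h
    obtain ⟨j, hj⟩ := h
    refine List.prod_eq_zero (List.mem_ofFn.mpr ⟨j, ?_⟩)
    rw [GradedAlgebra.proj_apply]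
    exact DirectSum.decompose_of_mem_ne _ (prod_fiber_mem_component f x d hd j) hj

end Coproduct

/-! ### The action of the descent algebra as convolution -/

section DescentAction

theorem monotone_index {r : ℕ} (ν : Composition r) : Monotone ν.index := by
  intro i j hij
  by_contra! hc
  have h1 := ν.sizeUpTo_index_le i
  have h2 := ν.lt_sizeUpTo_index_succ j
  have h3 := ν.monotone_sizeUpTo (show ((ν.index j : ℕ)).succ ≤ ν.index i from hc)
  have : (i : ℕ) ≤ j := hij
  simp only [Fin.val_succ] at h2
  simp only [Nat.succ_eq_add_one] at h3 h2
  omega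

theorem card_index_eq {r : ℕ} (ν : Composition r) (j : Fin ν.length) :
    (Finset.univ.filter fun i => ν.index i = j).card = ν.blocksFun j := by
  have h : (Finset.univ.filter fun i => ν.index i = j) =
      Finset.univ.map (ν.embedding j).toEmbedding := by
    ext i
    simp only [Finset.mem_filter, Finset.mem_univ, true_and, Finset.mem_map,
      RelEmbedding.coe_toEmbedding]
    rw [eq_comm, ← ν.mem_range_embedding_iff', Set.mem_range]
  rw [h, Finset.card_map, Finset.card_univ, Fintype.card_fin]

/-- The maps with fibres of sizes `ν₁, …, ν_k` are the rearrangements of the block index. -/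
theorem exists_perm_of_card_fibers {r : ℕ} (ν : Composition r) {f : Fin r → Fin ν.length}
    (hf : ∀ j, (Finset.univ.filter fun i => f i = j).card = ν.blocksFun j) :
    ∃ τ : Equiv.Perm (Fin r), ν.index ∘ τ = f := by
  have e : ∀ j, {i // f i = j} ≃ {i // ν.index i = j} := fun j => Fintype.equivOfCardEq (by
    rw [Fintype.card_subtype, Fintype.card_subtype, hf, card_index_eq])
  refine ⟨((Equiv.sigmaFiberEquiv f).symm.trans (Equiv.sigmaCongrRight e)).trans
    (Equiv.sigmaFiberEquiv ν.index), funext fun i => ?_⟩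
  exact (e (f i) ⟨i, rfl⟩).2

theorem comp_sort_eq_index {r : ℕ} (ν : Composition r) {f : Fin r → Fin ν.length}
    (hf : ∀ j, (Finset.univ.filter fun i => f i = j).card = ν.blocksFun j) :
    f ∘ Tuple.sort f = ν.index := by
  obtain ⟨τ, rfl⟩ := exists_perm_of_card_fibers ν hf
  rw [Tuple.comp_perm_comp_sort_eq_comp_sort,
    Tuple.sort_eq_refl_iff_monotone.mpr (monotone_index ν)]
  rfl

theorem sort_index_comp_symm {r : ℕ} {ν : Composition r} {π : Equiv.Perm (Fin r)}
    (h : IncreasingOnBlocks ν π) : Tuple.sort (ν.index ∘ π.symm) = π := by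
  symm
  rw [Tuple.eq_sort_iff]
  constructor
  · simpa [Function.comp_assoc] using monotone_index ν
  · intro i j hij he
    exact h i j hij (by simpa using he)

/-- The permutations occurring in `X^ν` are those which sort the maps with fibres of sizes
`ν₁, …, ν_k` stably. -/
theorem sum_increasingOnBlocks {r : ℕ} (ν : Composition r) {M : Type*} [AddCommMonoid M]
    (g : Equiv.Perm (Fin r) → M) :
    ∑ π with IncreasingOnBlocks ν π, g π =
      ∑ f ∈ contentMaps ν fun _ => 1, g (Tuple.sort f) := by
  refine Finset.sum_bij' (fun π _ => ν.index ∘ π.symm) (fun f _ => Tuple.sort f) ?_ ?_ ?_ ?_ ?_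
  · intro π _
    simp only [contentMaps, Finset.mem_filter, Finset.mem_univ, true_and, Finset.sum_const,
      smul_eq_mul, mul_one, Function.comp_apply]
    intro j
    rw [← card_index_eq]
    refine Finset.card_equiv π.symm fun i => ?_
    simp
  · intro f hf
    simp only [contentMaps, Finset.mem_filter, Finset.mem_univ, true_and, Finset.sum_const,
      smul_eq_mul, mul_one] at hf ⊢
    intro i j hij he
    have hs := ((Tuple.eq_sort_iff (σ := Tuple.sort f) (f := f)).mp rfl).2 i j hij
    rw [← comp_sort_eq_index ν hf] at he
    exact hs he
  · intro π hπ
    exact sort_index_comp_symm (Finset.mem_filter.mp hπ).2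
  · intro f hf
    simp only [contentMaps, Finset.mem_filter, Finset.mem_univ, true_and, Finset.sum_const,
      smul_eq_mul, mul_one] at hf
    simp only [← comp_sort_eq_index ν hf]
    funext i
    simp
  · intro π hπ
    rw [sort_index_comp_symm (Finset.mem_filter.mp hπ).2]

variable {F V : Type*} [Field F] [AddCommGroup V] [Module F V]

/-- The element `X^ν` acts on `T^r(V)` as the convolution product of the projections to the
homogeneous components of degrees `ν₁, …, ν_k`. -/
theorem toTensorAlgebra_descentElt {r : ℕ} (ν : Composition r) (t : ⨂[F]^r V) :
    TensorPower.toTensorAlgebra ((placeRep F V r).asAlgebraHom (descentElt F ν) t) =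
      convolution F V ν (TensorPower.toTensorAlgebra t) := by
  have h : TensorPower.toTensorAlgebra ∘ₗ (placeRep F V r).asAlgebraHom (descentElt F ν) =
      convolution F V ν ∘ₗ TensorPower.toTensorAlgebra := by
    ext v
    simp only [LinearMap.compMultilinearMap_apply, LinearMap.comp_apply,
      TensorPower.toTensorAlgebra_tprod, TensorAlgebra.tprod_apply]
    rw [convolution_prod ν _ (fun i => LieSubalgebra.subset_lieSpan ⟨v i, rfl⟩) (fun _ => 1)
      (fun i => by
        rw [component, pow_one]
        exact ⟨v i, rfl⟩), descentElt, map_sum, LinearMap.sum_apply, map_sum,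
      ← sum_increasingOnBlocks ν fun π =>
        (List.ofFn ((fun i => TensorAlgebra.ι F (v i)) ∘ π)).prod]
    refine Finset.sum_congr rfl fun π _ => ?_
    rw [Representation.asAlgebraHom_single_one, placeRep_tprod, TensorPower.toTensorAlgebra_tprod,
      TensorAlgebra.tprod_apply]
    rfl
  exact LinearMap.congr_fun h t

end DescentAction

/-! ### Values of Young characters -/

section YoungCharacter

theorem exists_equiv_of_map_eq {α β : Type*} [Fintype α] [Fintype β] (w : α → ℕ) (d : β → ℕ)
    (h : Finset.univ.val.map w = Finset.univ.val.map d) : ∃ e : α ≃ β, ∀ a, d (e a) = w a := by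
  classical
  have e : ∀ n, {a // w a = n} ≃ {b // d b = n} := fun n => Fintype.equivOfCardEq (by
    have := congrArg (Multiset.count n) h
    rw [Multiset.count_map, Multiset.count_map] at this
    rw [Fintype.card_subtype, Fintype.card_subtype]
    simpa only [Finset.card_def, Finset.filter_val, eq_comm] using this)
  exact ⟨((Equiv.sigmaFiberEquiv w).symm.trans (Equiv.sigmaCongrRight e)).trans
    (Equiv.sigmaFiberEquiv d), fun a => (e (w a) ⟨a, rfl⟩).2⟩

theorem apply_eq_of_sameCycle {r : ℕ} {X : Type*} {σ : Equiv.Perm (Fin r)} {h : Fin r → X}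
    (hσ : ∀ i, h (σ i) = h i) {a b : Fin r} (hab : σ.SameCycle a b) : h a = h b := by
  obtain ⟨n, -, rfl⟩ := hab.exists_pow_eq'
  induction n with
  | zero => rfl
  | succ n ih =>
    rw [pow_succ', Equiv.Perm.mul_apply, hσ]
    exact ih ⟨n, by simp⟩

/-- The cycles of a permutation, fixed points included, as the fibres of a map to `Fin m`. -/
theorem exists_cycle_map {r m : ℕ} (σ : Equiv.Perm (Fin r)) (d : Fin m → ℕ)
    (hd : Finset.univ.val.map d = (cycleShape σ).parts) :
    ∃ q : Fin r → Fin m, (∀ a, q (σ a) = q a) ∧ (∀ a b, q a = q b → σ.SameCycle a b) ∧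
      ∀ i, (Finset.univ.filter fun a => q a = i).card = d i := by
  classical
  let I := {c // c ∈ σ.cycleFactorsFinset} ⊕ {a // a ∉ σ.support}
  let w : I → ℕ := Sum.elim (fun c => c.1.support.card) fun _ => 1
  have hw : Finset.univ.val.map w = Finset.univ.val.map d := by
    rw [hd]
    change _ = σ.partition.parts
    rw [Equiv.Perm.parts_partition, Equiv.Perm.cycleType_def,
      ← Finset.univ_disjSum_univ, Finset.val_disjSum, Multiset.disjSum, Multiset.map_add,
      Multiset.map_map, Multiset.map_map]
    congr 1
    · change (Finset.univ : Finset {c // c ∈ σ.cycleFactorsFinset}).val.map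
        ((fun c : Equiv.Perm (Fin r) => c.support.card) ∘ Subtype.val) = _
      rw [← Multiset.map_map, Finset.univ_eq_attach, Finset.attach_val, Multiset.attach_map_val]
      rfl
    · change Multiset.map (fun _ => 1) _ = _
      rw [Multiset.map_const', ← Finset.card_def, Finset.card_univ, Fintype.card_subtype_compl,
        Fintype.card_coe]
  obtain ⟨e, he⟩ := exists_equiv_of_map_eq w d hw
  let q : Fin r → I := fun a =>
    if h : a ∈ σ.support then
      Sum.inl ⟨σ.cycleOf a, Equiv.Perm.cycleOf_mem_cycleFactorsFinset_iff.mpr h⟩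
    else Sum.inr ⟨a, h⟩
  have hq1 : ∀ a (h : a ∈ σ.support), q a =
      Sum.inl ⟨σ.cycleOf a, Equiv.Perm.cycleOf_mem_cycleFactorsFinset_iff.mpr h⟩ :=
    fun a h => dif_pos h
  have hq2 : ∀ a (h : a ∉ σ.support), q a = Sum.inr ⟨a, h⟩ := fun a h => dif_neg h
  refine ⟨e ∘ q, fun a => ?_, fun a b hab => ?_, fun i => ?_⟩
  · by_cases h : a ∈ σ.support
    · have h' : σ a ∈ σ.support := by simpa using h
      simp only [Function.comp_apply, hq1 a h, hq1 _ h']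
      congr 3
      exact (Equiv.Perm.SameCycle.cycleOf_eq (Equiv.Perm.sameCycle_apply_left.mpr
        (Equiv.Perm.SameCycle.refl σ a)))
    · rw [Equiv.Perm.notMem_support.mp h]
  · have hab' : q a = q b := e.injective hab
    by_cases ha : a ∈ σ.support <;> by_cases hb : b ∈ σ.support
    · rw [hq1 a ha, hq1 b hb] at hab'
      exact (Equiv.Perm.sameCycle_iff_cycleOf_eq_of_mem_support ha hb).mpr
        (congrArg Subtype.val (Sum.inl_injective hab'))
    · rw [hq1 a ha, hq2 b hb] at hab'
      exact absurd hab' Sum.inl_ne_inr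
    · rw [hq2 a ha, hq1 b hb] at hab'
      exact absurd hab' Sum.inr_ne_inl
    · rw [hq2 a ha, hq2 b hb] at hab'
      have : a = b := congrArg Subtype.val (Sum.inr_injective hab')
      rw [this]
  · obtain ⟨c, rfl⟩ := e.surjective i
    rw [he]
    simp only [Function.comp_apply, e.apply_eq_iff_eq]
    rcases c with ⟨c, hc⟩ | ⟨a, ha⟩
    · change _ = c.support.card
      congr 1
      ext a
      simp only [Finset.mem_filter, Finset.mem_univ, true_and]
      by_cases h : a ∈ σ.support
      · rw [hq1 a h, Sum.inl.injEq, Subtype.mk.injEq]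
        constructor
        · rintro rfl
          rw [Equiv.Perm.mem_support_cycleOf_iff]
          exact ⟨Equiv.Perm.SameCycle.refl σ a, h⟩
        · intro hac
          exact (Equiv.Perm.cycle_is_cycleOf hac hc).symm
      · rw [hq2 a h]
        refine iff_of_false Sum.inr_ne_inl fun hac => h ?_
        exact Equiv.Perm.mem_cycleFactorsFinset_support_le hc hac
    · change _ = 1
      rw [Finset.card_eq_one]
      refine ⟨a, ?_⟩
      ext b
      simp only [Finset.mem_filter, Finset.mem_univ, true_and, Finset.mem_singleton]
      constructor
      · intro hb
        by_cases h : b ∈ σ.support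
        · rw [hq1 b h] at hb
          exact absurd hb Sum.inl_ne_inr
        · rw [hq2 b h] at hb
          exact congrArg Subtype.val (Sum.inr_injective hb)
      · rintro rfl
        exact hq2 b ha

/-- The cosets of the Young subgroup of `ν` fixed by `σ` correspond to the maps with fibres of
sizes `ν₁, …, ν_k` which are constant on the cycles of `σ`. -/
theorem youngCharacter_eq_card_invariant {r : ℕ} (ν : Composition r) (σ : Equiv.Perm (Fin r)) :
    youngCharacter ν σ = Nat.card {h : Fin r → Fin ν.length // (∀ i, h (σ i) = h i) ∧
      ∀ j, (Finset.univ.filter fun i => h i = j).card = ν.blocksFun j} := by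
  have hmk : ∀ g : Equiv.Perm (Fin r),
      (g : Equiv.Perm (Fin r) ⧸ youngSubgroup ν) ∈
        MulAction.fixedBy (Equiv.Perm (Fin r) ⧸ youngSubgroup ν) σ ↔
        ∀ i, ν.index (g⁻¹ (σ i)) = ν.index (g⁻¹ i) := by
    intro g
    rw [MulAction.mem_fixedBy, MulAction.Quotient.smul_coe, smul_eq_mul, eq_comm, QuotientGroup.eq]
    change (∀ i, ν.index ((g⁻¹ * (σ * g)) i) = ν.index i) ↔ _
    constructor
    · intro h i
      simpa using h (g⁻¹ i)
    · intro h i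
      simpa using h (g i)
  let Φ : Equiv.Perm (Fin r) ⧸ youngSubgroup ν → Fin r → Fin ν.length :=
    Quotient.lift (fun g i => ν.index (g⁻¹ i)) (by
      intro g g' hg
      funext i
      have h := (QuotientGroup.leftRel_apply.mp hg) (g'⁻¹ i)
      simpa using h)
  have hΦ : ∀ g : Equiv.Perm (Fin r), Φ g = fun i => ν.index (g⁻¹ i) := fun g => rfl
  have hinj : Function.Injective Φ := by
    intro a b hab
    induction a using QuotientGroup.induction_on with | _ g =>
    induction b using QuotientGroup.induction_on with | _ g' =>
    rw [QuotientGroup.eq]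
    intro i
    have := congrFun hab (g' i)
    simpa [hΦ] using this
  refine Nat.card_congr (Equiv.ofBijective (fun c => ⟨Φ c.1, ?_, ?_⟩) ⟨?_, ?_⟩)
  · obtain ⟨c, hc⟩ := c
    induction c using QuotientGroup.induction_on with | _ g =>
    exact (hmk g).mp hc
  · obtain ⟨c, hc⟩ := c
    induction c using QuotientGroup.induction_on with | _ g =>
    intro j
    rw [← card_index_eq]
    refine Finset.card_equiv g⁻¹ fun i => ?_
    simp [hΦ]
  · intro a b hab
    exact Subtype.ext (hinj (congrArg Subtype.val hab))
  · rintro ⟨h, h1, h2⟩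
    obtain ⟨τ, rfl⟩ := exists_perm_of_card_fibers ν h2
    refine ⟨⟨((τ⁻¹ : Equiv.Perm (Fin r)) : Equiv.Perm (Fin r) ⧸ youngSubgroup ν), ?_⟩, ?_⟩
    · rw [hmk]
      simpa using h1
    · refine Subtype.ext ?_
      simp only [hΦ, inv_inv]
      rfl

/-- The value of a Young character at a permutation with cycle lengths `d i` counts the
distributions of the cycles to the blocks which fill the blocks. -/
theorem youngCharacter_eq_card {r m : ℕ} (ν : Composition r) (σ : Equiv.Perm (Fin r))
    (d : Fin m → ℕ) (hd : Finset.univ.val.map d = (cycleShape σ).parts) :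
    youngCharacter ν σ = (contentMaps ν d).card := by
  obtain ⟨q, hqσ, hq, hcard⟩ := exists_cycle_map σ d hd
  have hsurj : Function.Surjective q := by
    intro i
    have hpos : 0 < d i := (cycleShape σ).parts_pos (by
      rw [← hd]
      exact Multiset.mem_map_of_mem d (Finset.mem_univ i))
    rw [← hcard i, Finset.card_pos] at hpos
    obtain ⟨a, ha⟩ := hpos
    exact ⟨a, (Finset.mem_filter.mp ha).2⟩
  have hfib : ∀ (f : Fin m → Fin ν.length) j,
      (Finset.univ.filter fun a => f (q a) = j).card = ∑ i with f i = j, d i := by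
    intro f j
    rw [Finset.card_eq_sum_card_fiberwise (f := q) (t := Finset.univ.filter fun i => f i = j)]
    · refine Finset.sum_congr rfl fun i hi => ?_
      rw [← hcard i, Finset.filter_filter]
      congr 1
      ext a
      simp only [Finset.mem_filter, Finset.mem_univ, true_and] at hi ⊢
      constructor
      · exact fun h => h.2
      · rintro rfl
        exact ⟨hi, rfl⟩
    · intro a ha
      simpa using ha
  have hmem : ∀ f : Fin m → Fin ν.length, f ∈ contentMaps ν d ↔
      ∀ j, (Finset.univ.filter fun a => f (q a) = j).card = ν.blocksFun j := by
    intro f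
    simp only [contentMaps, Finset.mem_filter, Finset.mem_univ, true_and, hfib]
  rw [youngCharacter_eq_card_invariant, ← Nat.card_eq_finsetCard]
  refine (Nat.card_congr (Equiv.ofBijective
    (fun f => ⟨f.1 ∘ q, fun i => by simp [hqσ], (hmem f.1).mp f.2⟩) ⟨?_, ?_⟩)).symm
  · intro f g hfg
    exact Subtype.ext (hsurj.injective_comp_right (congrArg Subtype.val hfg))
  · rintro ⟨h, h1, h2⟩
    have hfac : h ∘ Function.surjInv hsurj ∘ q = h := by
      funext a
      exact apply_eq_of_sameCycle h1 (hq _ _ (Function.surjInv_eq hsurj (q a)))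
    refine ⟨⟨h ∘ Function.surjInv hsurj, (hmem _).mpr ?_⟩, Subtype.ext hfac⟩
    intro j
    rw [← h2 j]
    congr 1
    ext a
    simp only [Finset.mem_filter, Finset.mem_univ, true_and]
    rw [← congrFun hfac a]
    rfl

end YoungCharacter

variable {F V : Type*} [Field F] [AddCommGroup V] [Module F V]

/-! ### Tensor powers as components of the tensor algebra -/

section TensorPowerComponent

theorem toTensorAlgebra_mem_component {n : ℕ} (t : ⨂[F]^n V) :
    TensorPower.toTensorAlgebra t ∈ component F V n := by
  have h : LinearMap.range (TensorPower.toTensorAlgebra : ⨂[F]^n V →ₗ[F] TensorAlgebra F V) ≤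
      component F V n := by
    rw [LinearMap.range_eq_map, ← PiTensorProduct.span_tprod_eq_top, Submodule.map_span,
      Submodule.span_le]
    rintro _ ⟨_, ⟨v, rfl⟩, rfl⟩
    rw [TensorPower.toTensorAlgebra_tprod, TensorAlgebra.tprod_apply, SetLike.mem_coe]
    have := SetLike.list_prod_ofFn_mem_graded (A := component F V) (fun _ : Fin n => 1)
      (fun i => TensorAlgebra.ι F (v i)) fun i => by
        rw [component, pow_one]
        exact ⟨v i, rfl⟩
    simpa using this
  exact h ⟨t, rfl⟩

theorem exists_toTensorAlgebra_eq {n : ℕ} {a : TensorAlgebra F V} (ha : a ∈ component F V n) :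
    ∃ t : ⨂[F]^n V, TensorPower.toTensorAlgebra t = a := by
  suffices h : component F V n ≤
      LinearMap.range (TensorPower.toTensorAlgebra : ⨂[F]^n V →ₗ[F] TensorAlgebra F V) from h ha
  rw [component, LinearMap.range_eq_map, ← Submodule.span_univ, Submodule.map_span,
    Submodule.span_pow, Submodule.span_le]
  intro a ha
  obtain ⟨f, rfl⟩ := Set.mem_pow.mp ha
  choose v _ hv using fun i => (f i).2
  refine ⟨PiTensorProduct.tprod F v, ?_⟩
  rw [TensorPower.toTensorAlgebra_tprod, TensorAlgebra.tprod_apply]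
  simp only [hv]

theorem toTensorAlgebra_injective (n : ℕ) :
    Function.Injective (TensorPower.toTensorAlgebra : ⨂[F]^n V →ₗ[F] TensorAlgebra F V) := by
  have h : (TensorPower.toTensorAlgebra : ⨂[F]^n V →ₗ[F] TensorAlgebra F V) =
      (TensorAlgebra.ofDirectSum (R := F) (M := V)).toLinearMap ∘ₗ
        DirectSum.lof F ℕ (fun n => ⨂[F]^n V) n := by
    ext v
    simp [DirectSum.lof_eq_of, TensorAlgebra.ofDirectSum_of_tprod]
  intro s t hst
  rw [h] at hst
  exact DirectSum.of_injective n
    ((Function.LeftInverse.injective TensorAlgebra.toDirectSum_ofDirectSum) hst)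

end TensorPowerComponent

/-! ### A homogeneous basis of the free Lie algebra -/

section LieBasis

variable (F V) in
/-- The Lie power `L^n(V)` as a subspace of `T^n(V)`. -/
noncomputable abbrev liePiece (n : ℕ) : Submodule F (⨂[F]^n V) :=
  (freeLie F V).toSubmodule.comap TensorPower.toTensorAlgebra

variable (F V) in
/-- The homogeneous part of degree `n + 1` of the free Lie algebra, as a subspace of the latter. -/
noncomputable def homogeneousLie (n : ℕ) : Submodule F (freeLie F V) :=
  (component F V (n + 1)).comap (freeLie F V).toSubmodule.subtype

/-- The Lie power `L^{n+1}(V)` is the homogeneous part of degree `n + 1` of the free Lie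
algebra. -/
noncomputable def liePieceEquiv (n : ℕ) : liePiece F V (n + 1) ≃ₗ[F] homogeneousLie F V n :=
  LinearEquiv.ofBijective
    (LinearMap.codRestrict (homogeneousLie F V n)
      (LinearMap.codRestrict (freeLie F V).toSubmodule
        (TensorPower.toTensorAlgebra ∘ₗ (liePiece F V (n + 1)).subtype) fun t => t.2)
      fun t => toTensorAlgebra_mem_component (t : ⨂[F]^(n + 1) V))
    ⟨fun s t hst => Subtype.ext (toTensorAlgebra_injective (n + 1)
        (congrArg (fun x : homogeneousLie F V n => ((x : freeLie F V) : TensorAlgebra F V)) hst)),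
      fun x => by
        obtain ⟨t, ht⟩ := exists_toTensorAlgebra_eq (n := n + 1)
          (a := ((x : freeLie F V) : TensorAlgebra F V)) x.2
        refine ⟨⟨t, ?_⟩, Subtype.ext (Subtype.ext ht)⟩
        change TensorPower.toTensorAlgebra t ∈ freeLie F V
        rw [ht]
        exact x.1.2⟩

/-- The free Lie algebra is spanned by homogeneous Lie elements of positive degree. -/
theorem freeLie_le_iSup :
    (freeLie F V).toSubmodule ≤
      ⨆ n, (freeLie F V).toSubmodule ⊓ component F V (n + 1) := by
  intro x hx
  rw [LieSubalgebra.mem_toSubmodule] at hx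
  unfold freeLie at hx
  induction hx using LieSubalgebra.lieSpan_induction with
  | mem x h =>
    refine Submodule.mem_iSup_of_mem 0 ⟨LieSubalgebra.subset_lieSpan h, ?_⟩
    rw [SetLike.mem_coe, component, zero_add, pow_one]
    obtain ⟨v, rfl⟩ := h
    exact ⟨v, rfl⟩
  | zero => exact zero_mem _
  | add x y _ _ hx hy => exact add_mem hx hy
  | smul a x _ hx => exact Submodule.smul_mem _ _ hx
  | lie x y _ _ hx hy =>
    clear * - hx hy
    induction hx using Submodule.iSup_induction' with
    | zero => rw [zero_lie]; exact zero_mem _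
    | add x x' _ _ hx hx' => rw [add_lie]; exact add_mem hx hx'
    | mem m x hx =>
      induction hy using Submodule.iSup_induction' with
      | zero => rw [lie_zero]; exact zero_mem _
      | add y y' _ _ hy hy' => rw [lie_add]; exact add_mem hy hy'
      | mem n y hy =>
        refine Submodule.mem_iSup_of_mem (m + n + 1)
          ⟨(freeLie F V).lie_mem hx.1 hy.1, ?_⟩
        rw [LieRing.of_associative_ring_bracket]
        refine sub_mem ?_ ?_
        · have := SetLike.mul_mem_graded (A := component F V) hx.2 hy.2
          rwa [show m + 1 + (n + 1) = m + n + 1 + 1 by ring] at this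
        · have := SetLike.mul_mem_graded (A := component F V) hy.2 hx.2
          rwa [show n + 1 + (m + 1) = m + n + 1 + 1 by ring] at this

theorem isInternal_homogeneousLie : DirectSum.IsInternal (homogeneousLie F V) := by
  refine DirectSum.isInternal_submodule_of_iSupIndep_of_iSup_eq_top ?_ ?_
  · intro n
    rw [Submodule.disjoint_def]
    intro x hx hx'
    have hind := (DirectSum.Decomposition.isInternal (component F V)).submodule_iSupIndep (n + 1)
    rw [Submodule.disjoint_def] at hind
    refine Subtype.ext (hind x hx ?_)
    have h := Submodule.mem_map_of_mem (f := (freeLie F V).toSubmodule.subtype) hx'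
    simp only [Submodule.map_iSup] at h
    refine (iSup₂_le fun m hm => ?_ :
      (⨆ j, ⨆ (_ : j ≠ n), (homogeneousLie F V j).map (freeLie F V).toSubmodule.subtype) ≤ _) h
    refine le_trans ?_ (le_iSup₂_of_le (m + 1) (by simpa using hm) le_rfl)
    rintro _ ⟨y, hy, rfl⟩
    exact hy
  · rw [eq_top_iff]
    rintro ⟨x, hx⟩ -
    have h := freeLie_le_iSup hx
    have h2 : (⨆ n, (freeLie F V).toSubmodule ⊓ component F V (n + 1)) ≤
        (⨆ n, homogeneousLie F V n).map (freeLie F V).toSubmodule.subtype := by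
      refine iSup_le fun n y hy => ?_
      exact ⟨⟨y, hy.1⟩, Submodule.mem_iSup_of_mem n hy.2, rfl⟩
    obtain ⟨y, hy, rfl⟩ := h2 h
    exact hy

variable (F V) in
/-- The index set of a chosen homogeneous basis of the free Lie algebra; the first component of an
index is the degree of the basis element minus one. -/
abbrev LieIndex : Type _ := Σ n : ℕ, Module.Basis.ofVectorSpaceIndex F (liePiece F V (n + 1))

/-- A total order of the basis elements. -/
noncomputable instance : LinearOrder (LieIndex F V) := IsWellOrder.linearOrder WellOrderingRel

variable (F V) in
/-- The chosen basis of the Lie power `L^{n+1}(V)`. -/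
noncomputable def pieceBasis (n : ℕ) :
    Module.Basis (Module.Basis.ofVectorSpaceIndex F (liePiece F V (n + 1))) F
      (liePiece F V (n + 1)) :=
  Module.Basis.ofVectorSpace F _

variable (F V) in
/-- The chosen homogeneous basis of the free Lie algebra. -/
noncomputable def lieBasis : Module.Basis (LieIndex F V) F (freeLie F V) :=
  isInternal_homogeneousLie.collectedBasis fun n => (pieceBasis F V n).map (liePieceEquiv n)

theorem coe_lieBasis (i : LieIndex F V) :
    (lieBasis F V i : TensorAlgebra F V) =
      TensorPower.toTensorAlgebra (pieceBasis F V i.1 i.2 : ⨂[F]^(i.1 + 1) V) := by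
  rw [lieBasis, DirectSum.IsInternal.collectedBasis_coe]
  rfl

/-- The degree of a basis element. -/
def degree (i : LieIndex F V) : ℕ := i.1 + 1

theorem lieBasis_mem_component (i : LieIndex F V) :
    (lieBasis F V i : TensorAlgebra F V) ∈ component F V (degree i) := by
  rw [coe_lieBasis]
  exact toTensorAlgebra_mem_component _

theorem mem_span_lieBasis {n : ℕ} (hn : 0 < n) {x : TensorAlgebra F V} (hx : x ∈ freeLie F V)
    (hxn : x ∈ component F V n) :
    x ∈ Submodule.span F {a : TensorAlgebra F V |
      ∃ i : LieIndex F V, degree i = n ∧ (lieBasis F V i : TensorAlgebra F V) = a} := by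
  obtain ⟨n, rfl⟩ : ∃ k, n = k + 1 := ⟨n - 1, by omega⟩
  obtain ⟨t, rfl⟩ := exists_toTensorAlgebra_eq hxn
  have h := (pieceBasis F V n).mem_span ⟨t, hx⟩
  have h2 := Submodule.mem_map_of_mem
    (f := TensorPower.toTensorAlgebra ∘ₗ (liePiece F V (n + 1)).subtype) h
  rw [Submodule.map_span] at h2
  refine Submodule.span_mono ?_ h2
  rintro _ ⟨_, ⟨k, rfl⟩, rfl⟩
  exact ⟨⟨n, k⟩, rfl, coe_lieBasis _⟩

variable (F V) in
/-- The action of the tensor algebra on the polynomials in the basis elements of the free Lie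
algebra which extends the Poincaré–Birkhoff–Witt representation. -/
noncomputable def tensorAction :
    TensorAlgebra F V →ₐ[F] Module.End F (Multiset (LieIndex F V) →₀ F) :=
  TensorAlgebra.lift F ((pbwRep (lieBasis F V) : freeLie F V →ₗ[F] _) ∘ₗ
    LinearMap.codRestrict (freeLie F V).toSubmodule (TensorAlgebra.ι F)
      fun v => LieSubalgebra.subset_lieSpan ⟨v, rfl⟩)

theorem tensorAction_coe (x : freeLie F V) :
    tensorAction F V x = pbwRep (lieBasis F V) x := by
  suffices h : ∀ y ∈ freeLie F V, ∃ hy : y ∈ freeLie F V,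
      tensorAction F V y = pbwRep (lieBasis F V) ⟨y, hy⟩ by
    obtain ⟨_, h⟩ := h x x.2
    exact h
  intro y hy
  unfold freeLie at hy
  induction hy using LieSubalgebra.lieSpan_induction with
  | mem y h =>
    refine ⟨LieSubalgebra.subset_lieSpan h, ?_⟩
    obtain ⟨v, rfl⟩ := h
    simp only [tensorAction, TensorAlgebra.lift_ι_apply]
    rfl
  | zero =>
    exact ⟨zero_mem _, (map_zero _).trans (map_zero (pbwRep (lieBasis F V))).symm⟩
  | add y z _ _ hy hz =>
    obtain ⟨hy, ey⟩ := hy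
    obtain ⟨hz, ez⟩ := hz
    refine ⟨add_mem hy hz, ?_⟩
    rw [map_add, ey, ez, ← map_add (pbwRep (lieBasis F V))]
    exact congrArg _ (Subtype.ext rfl)
  | smul a y _ hy =>
    obtain ⟨hy, ey⟩ := hy
    refine ⟨(freeLie F V).smul_mem a hy, ?_⟩
    rw [map_smul, ey, ← map_smul (pbwRep (lieBasis F V))]
    exact congrArg _ (Subtype.ext rfl)
  | lie y z _ _ hy hz =>
    obtain ⟨hy, ey⟩ := hy
    obtain ⟨hz, ez⟩ := hz
    refine ⟨(freeLie F V).lie_mem hy hz, ?_⟩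
    have h : tensorAction F V ⁅y, z⁆ = ⁅tensorAction F V y, tensorAction F V z⁆ := by
      simp only [LieRing.of_associative_ring_bracket, map_sub, map_mul]
      rfl
    rw [h, ey, ez, ← LieHom.map_lie]
    exact congrArg _ (Subtype.ext rfl)

/-- The product of the basis elements indexed by a multiset, in increasing order. -/
noncomputable def sortedProd (S : Multiset (LieIndex F V)) : TensorAlgebra F V :=
  ((S.sort (· ≤ ·)).map fun i => (lieBasis F V i : TensorAlgebra F V)).prod

variable (F V) in
/-- The Poincaré–Birkhoff–Witt theorem for the free Lie algebra in the tensor algebra. -/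
theorem linearIndependent_sortedProd :
    LinearIndependent F (sortedProd : Multiset (LieIndex F V) → TensorAlgebra F V) :=
  linearIndependent_sorted_prod (lieBasis F V) (fun x => (x : TensorAlgebra F V))
    (tensorAction F V) tensorAction_coe

end LieBasis

/-! ### The filtration by products of Lie elements -/

section Filtration

variable (F V) in
/-- A list of Lie elements which are homogeneous of the degrees listed along with them. -/
def IsLieList (l : List (ℕ × TensorAlgebra F V)) : Prop :=
  ∀ p ∈ l, p.2 ∈ freeLie F V ∧ p.2 ∈ component F V p.1

variable (F V) in
/-- The span of the products of homogeneous Lie elements whose multiset of degrees is in `Q`. -/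
noncomputable def lieProducts (Q : Set (Multiset ℕ)) : Submodule F (TensorAlgebra F V) :=
  Submodule.span F {a | ∃ l : List (ℕ × TensorAlgebra F V), IsLieList F V l ∧
    (l.map Prod.fst : Multiset ℕ) ∈ Q ∧ (l.map Prod.snd).prod = a}

/-- Every multiset which arises from `m` by replacing two elements by their sum is in `Q`. -/
def MergesInto (m : Multiset ℕ) (Q : Set (Multiset ℕ)) : Prop :=
  ∀ a b t, m = a ::ₘ b ::ₘ t → (a + b) ::ₘ t ∈ Q

theorem prod_mem_lieProducts {Q : Set (Multiset ℕ)} {l : List (ℕ × TensorAlgebra F V)}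
    (hl : IsLieList F V l) (hQ : (l.map Prod.fst : Multiset ℕ) ∈ Q) :
    (l.map Prod.snd).prod ∈ lieProducts F V Q :=
  Submodule.subset_span ⟨l, hl, hQ, rfl⟩

theorem lieProducts_mono {Q Q' : Set (Multiset ℕ)} (h : Q ⊆ Q') :
    lieProducts F V Q ≤ lieProducts F V Q' :=
  Submodule.span_mono fun _ ⟨l, hl, hQ, e⟩ => ⟨l, hl, h hQ, e⟩

theorem mul_mem_lieProducts {Q Q' : Set (Multiset ℕ)} {n : ℕ} {x a : TensorAlgebra F V}
    (hx : x ∈ freeLie F V) (hxn : x ∈ component F V n) (hQ : ∀ m ∈ Q, n ::ₘ m ∈ Q')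
    (ha : a ∈ lieProducts F V Q) : x * a ∈ lieProducts F V Q' := by
  induction ha using Submodule.span_induction with
  | zero => rw [mul_zero]; exact zero_mem _
  | add a b _ _ ha hb => rw [mul_add]; exact add_mem ha hb
  | smul c a _ ha => rw [mul_smul_comm]; exact Submodule.smul_mem _ _ ha
  | mem a h =>
    obtain ⟨l, hl, hlQ, rfl⟩ := h
    exact prod_mem_lieProducts (l := (n, x) :: l) (List.forall_mem_cons.mpr ⟨⟨hx, hxn⟩, hl⟩)
      (hQ _ hlQ)

/-- Permuting the factors of a product of homogeneous Lie elements changes it by products in which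
two of the factors are merged to their Lie bracket. -/
theorem prod_sub_prod_mem_of_perm {l l' : List (ℕ × TensorAlgebra F V)} (h : l.Perm l')
    (hl : IsLieList F V l) {Q : Set (Multiset ℕ)}
    (hQ : MergesInto (l.map Prod.fst : Multiset ℕ) Q) :
    (l.map Prod.snd).prod - (l'.map Prod.snd).prod ∈ lieProducts F V Q := by
  induction h generalizing Q with
  | nil => rw [sub_self]; exact zero_mem _
  | cons x _ ih =>
    rw [IsLieList, List.forall_mem_cons] at hl
    simp only [List.map_cons, List.prod_cons]
    rw [← mul_sub]
    refine mul_mem_lieProducts (Q := {m | x.1 ::ₘ m ∈ Q}) hl.1.1 hl.1.2 (fun m hm => hm)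
      (ih hl.2 ?_)
    intro a b t h
    rw [Set.mem_ofPred_eq, Multiset.cons_swap]
    refine hQ a b _ ?_
    rw [List.map_cons, ← Multiset.cons_coe, h, Multiset.cons_swap x.1, Multiset.cons_swap x.1]
  | swap x y l =>
    simp only [IsLieList, List.forall_mem_cons] at hl
    obtain ⟨hy, hx, hl⟩ := hl
    simp only [List.map_cons, List.prod_cons]
    rw [← mul_assoc, ← mul_assoc, ← sub_mul, ← LieRing.of_associative_ring_bracket]
    refine prod_mem_lieProducts (l := (y.1 + x.1, ⁅y.2, x.2⁆) :: l)
      (List.forall_mem_cons.mpr ⟨⟨(freeLie F V).lie_mem hy.1 hx.1, ?_⟩, hl⟩)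
      (hQ y.1 x.1 (l.map Prod.fst : Multiset ℕ) rfl)
    rw [LieRing.of_associative_ring_bracket]
    refine sub_mem (SetLike.mul_mem_graded (A := component F V) hy.2 hx.2) ?_
    have := SetLike.mul_mem_graded (A := component F V) hx.2 hy.2
    rwa [add_comm] at this
  | @trans l₁ l₂ l₃ h₁ h₂ ih₁ ih₂ =>
    rw [← sub_add_sub_cancel _ (l₂.map Prod.snd).prod]
    refine add_mem (ih₁ hl hQ) (ih₂ (fun p hp => hl p (h₁.mem_iff.mpr hp)) ?_)
    rwa [← Multiset.coe_eq_coe.mpr (h₁.map Prod.fst)]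

/-- The convolution operator of a composition acts on a product of Lie elements as a scalar, up to
products with merged factors. -/
theorem convolution_sub_smul_mem {r : ℕ} (ν : Composition r) {l : List (ℕ × TensorAlgebra F V)}
    (hl : IsLieList F V l) {Q : Set (Multiset ℕ)}
    (hQ : MergesInto (l.map Prod.fst : Multiset ℕ) Q) :
    convolution F V ν (l.map Prod.snd).prod -
      ((contentMaps ν fun i => (l.get i).1).card : F) • (l.map Prod.snd).prod ∈
        lieProducts F V Q := by
  have hx : (l.map Prod.snd).prod = (List.ofFn fun i => (l.get i).2).prod := by
    conv_lhs => rw [← List.ofFn_get l, List.map_ofFn]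
    rfl
  rw [hx, convolution_prod ν _ (fun i => (hl _ (l.get_mem i)).1) _
    (fun i => (hl _ (l.get_mem i)).2), Nat.cast_smul_eq_nsmul, ← Finset.sum_const,
    ← Finset.sum_sub_distrib]
  refine sum_mem fun f _ => ?_
  have hperm : l.Perm (List.ofFn fun i => l.get (Tuple.sort f i)) := by
    conv_lhs => rw [← List.ofFn_get l]
    exact ((Tuple.sort f).ofFn_comp_perm l.get).symm
  have := prod_sub_prod_mem_of_perm hperm hl hQ
  rw [hx, List.map_ofFn] at this
  rw [← neg_sub]
  exact neg_mem this

theorem prod_mem_span_prod_lieBasis {l : List (ℕ × TensorAlgebra F V)} (hl : IsLieList F V l)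
    (hpos : ∀ p ∈ l, 0 < p.1) :
    (l.map Prod.snd).prod ∈ Submodule.span F {a : TensorAlgebra F V |
      ∃ l' : List (LieIndex F V), l'.map degree = l.map Prod.fst ∧
        (l'.map fun i => (lieBasis F V i : TensorAlgebra F V)).prod = a} := by
  induction l with
  | nil => exact Submodule.subset_span ⟨[], rfl, rfl⟩
  | cons p l ih =>
    rw [IsLieList, List.forall_mem_cons] at hl
    rw [List.forall_mem_cons] at hpos
    have h := Submodule.mul_mem_mul (mem_span_lieBasis hpos.1 hl.1.1 hl.1.2) (ih hl.2 hpos.2)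
    rw [Submodule.span_mul_span] at h
    refine Submodule.span_mono ?_ h
    rintro _ ⟨_, ⟨i, hi, rfl⟩, _, ⟨l', hl', rfl⟩, rfl⟩
    exact ⟨i :: l', by rw [List.map_cons, List.map_cons, hi, hl'], by
      rw [List.map_cons, List.prod_cons]⟩

/-- The list of the basis elements with given indices, together with their degrees. -/
noncomputable def basisList (l : List (LieIndex F V)) : List (ℕ × TensorAlgebra F V) :=
  l.map fun i => (degree i, (lieBasis F V i : TensorAlgebra F V))

theorem isLieList_basisList (l : List (LieIndex F V)) : IsLieList F V (basisList l) := by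
  intro p hp
  obtain ⟨i, -, rfl⟩ := List.mem_map.mp hp
  exact ⟨(lieBasis F V i).2, lieBasis_mem_component i⟩

theorem map_fst_basisList (l : List (LieIndex F V)) :
    (basisList l).map Prod.fst = l.map degree := by
  simp [basisList]

theorem map_snd_basisList (l : List (LieIndex F V)) :
    (basisList l).map Prod.snd = l.map fun i => (lieBasis F V i : TensorAlgebra F V) := by
  simp [basisList]

/-- A product of basis elements agrees with the sorted product up to products with merged
factors. -/
theorem prod_sub_sortedProd_mem (l : List (LieIndex F V)) {Q : Set (Multiset ℕ)}
    (hQ : MergesInto (l.map degree : Multiset ℕ) Q) :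
    (l.map fun i => (lieBasis F V i : TensorAlgebra F V)).prod -
      sortedProd (l : Multiset (LieIndex F V)) ∈ lieProducts F V Q := by
  have hperm : (basisList l).Perm (basisList ((l : Multiset (LieIndex F V)).sort (· ≤ ·))) := by
    refine List.Perm.map _ ?_
    rw [← Multiset.coe_eq_coe, Multiset.sort_eq]
  have := prod_sub_prod_mem_of_perm hperm (isLieList_basisList l) (Q := Q)
    (by rwa [map_fst_basisList])
  rwa [map_snd_basisList, map_snd_basisList] at this

theorem sortedProd_mem_lieProducts {S : Multiset (LieIndex F V)} {Q : Set (Multiset ℕ)}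
    (hS : S.map degree ∈ Q) : sortedProd S ∈ lieProducts F V Q := by
  rw [sortedProd, ← map_snd_basisList]
  refine prod_mem_lieProducts (isLieList_basisList _) ?_
  rwa [map_fst_basisList, ← Multiset.map_coe, Multiset.sort_eq]

/-- If a set of degree multisets is closed under merging, then the span of the corresponding
products of Lie elements is spanned by the sorted products of basis elements among them. -/
theorem lieProducts_eq_span_sortedProd {Q : Set (Multiset ℕ)} (hpos : ∀ m ∈ Q, ∀ n ∈ m, 0 < n)
    (hQ : ∀ m ∈ Q, MergesInto m Q) :
    lieProducts F V Q = Submodule.span F (sortedProd '' {S | S.map degree ∈ Q}) := by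
  refine le_antisymm ?_ (Submodule.span_le.mpr ?_)
  swap
  · rintro _ ⟨S, hS, rfl⟩
    exact sortedProd_mem_lieProducts hS
  have key : ∀ n, lieProducts F V (Q ∩ {m | m.card < n}) ≤
      Submodule.span F (sortedProd '' {S : Multiset (LieIndex F V) | S.map degree ∈ Q}) := by
    intro n
    induction n with
    | zero =>
      refine Submodule.span_le.mpr ?_
      rintro _ ⟨l, -, ⟨-, h⟩, rfl⟩
      exact absurd h (Nat.not_lt_zero _)
    | succ n ih =>
      refine Submodule.span_le.mpr ?_
      rintro _ ⟨l, hl, ⟨hlQ, hcard⟩, rfl⟩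
      refine Submodule.span_le.mpr ?_ (prod_mem_span_prod_lieBasis hl fun p hp =>
        hpos _ hlQ _ (Multiset.mem_coe.mpr (List.mem_map_of_mem hp)))
      rintro _ ⟨l', hl', rfl⟩
      rw [← hl'] at hlQ hcard
      rw [SetLike.mem_coe, ← sub_add_cancel
        (l'.map fun i => (lieBasis F V i : TensorAlgebra F V)).prod
        (sortedProd (l' : Multiset (LieIndex F V)))]
      refine add_mem (ih (prod_sub_sortedProd_mem l' fun a b t h => ⟨hQ _ hlQ a b t h, ?_⟩))
        (Submodule.subset_span ⟨_, by simpa using hlQ, rfl⟩)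
      rw [h] at hcard
      simp only [Set.mem_ofPred_eq, Multiset.card_cons] at hcard ⊢
      omega
  refine Submodule.span_le.mpr ?_
  rintro _ ⟨l, hl, hlQ, rfl⟩
  exact key (l.length + 1) (prod_mem_lieProducts hl ⟨hlQ, by simp⟩)

theorem lieProducts_empty : lieProducts F V ∅ = ⊥ := by
  rw [lieProducts, Submodule.span_eq_bot]
  rintro _ ⟨l, -, h, -⟩
  exact absurd h (Set.notMem_empty _)

end Filtration

/-! ### Higher Lie modules as factors of the filtration -/

section MonomialBasis

open Classical in
/-- The monomials in polynomial variables, indexed by multisets of variables. -/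
noncomputable def monomialBasis (F σ : Type*) [Field F] :
    Module.Basis (Multiset σ) F (MvPolynomial σ F) :=
  (MvPolynomial.basisMonomials σ F).reindex Multiset.toFinsupp.symm.toEquiv

theorem monomialBasis_apply {F σ : Type*} [Field F] (S : Multiset σ) :
    monomialBasis F σ S = (S.map MvPolynomial.X).prod := by
  classical
  rw [monomialBasis, Module.Basis.reindex_apply, MvPolynomial.coe_basisMonomials]
  change MvPolynomial.monomial (Multiset.toFinsupp S) 1 = _
  induction S using Multiset.induction_on with
  | empty => simp
  | cons i S ih =>
    rw [Multiset.map_cons, Multiset.prod_cons, ← ih, MvPolynomial.X, MvPolynomial.monomial_mul,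
      mul_one, ← Multiset.singleton_add, map_add, Multiset.toFinsupp_singleton]

end MonomialBasis

section SigmaUnion

variable {κ : ℕ → Type*} {r : ℕ}

/-- The disjoint union of a family of multisets. -/
def sigmaUnion (s : ∀ i : Fin r, Multiset (κ i)) : Multiset (Σ n, κ n) :=
  ∑ i : Fin r, (s i).map (Sigma.mk (i : ℕ))

theorem sigmaUnion_injective :
    Function.Injective (sigmaUnion : (∀ i : Fin r, Multiset (κ i)) → Multiset (Σ n, κ n)) := by
  classical
  have h : ∀ (s : ∀ i : Fin r, Multiset (κ i)) (i : Fin r) (k : κ i),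
      (sigmaUnion s).count ⟨i, k⟩ = (s i).count k := by
    intro s i k
    rw [sigmaUnion, Multiset.count_sum', Finset.sum_eq_single i]
    · exact Multiset.count_map_eq_count' _ _ sigma_mk_injective k
    · intro j _ hji
      rw [Multiset.count_eq_zero]
      intro h
      obtain ⟨k', -, hk'⟩ := Multiset.mem_map.mp h
      exact hji (Fin.ext (congrArg Sigma.fst hk'))
    · simp
  intro s t hst
  funext i
  refine Multiset.ext' fun k => ?_
  rw [← h s, hst, h]

theorem exists_sigmaUnion_eq {S : Multiset (Σ n, κ n)} (hS : ∀ x ∈ S, x.1 < r) :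
    ∃ s : ∀ i : Fin r, Multiset (κ i), sigmaUnion s = S := by
  classical
  induction S using Multiset.induction_on with
  | empty => exact ⟨fun _ => 0, by simp [sigmaUnion]⟩
  | cons x S ih =>
    obtain ⟨s, rfl⟩ := ih fun y hy => hS y (Multiset.mem_cons_of_mem hy)
    obtain ⟨n, k⟩ := x
    obtain ⟨i, rfl⟩ : ∃ i : Fin r, (i : ℕ) = n := ⟨⟨n, hS _ (Multiset.mem_cons_self _ _)⟩, rfl⟩
    refine ⟨s + Pi.single i {k}, ?_⟩
    simp only [sigmaUnion, Pi.add_apply, Multiset.map_add, Finset.sum_add_distrib]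
    rw [Finset.sum_eq_single (f := fun j : Fin r =>
      Multiset.map (Sigma.mk (j : ℕ)) (Pi.single (M := fun i : Fin r => Multiset (κ i)) i {k} j)) i]
    · rw [Pi.single_eq_same, Multiset.map_singleton, add_comm, Multiset.singleton_add]
    · intro j _ hji
      rw [Pi.single_eq_of_ne hji, Multiset.map_zero]
    · simp

end SigmaUnion

section Graded

variable {F V : Type*} [Field F] [AddCommGroup V] [Module F V]

variable (F V) in
/-- The linear map from the polynomials in the basis elements of the free Lie algebra to the tensor
algebra which orders the factors of monomials increasingly. -/
noncomputable def ofPolynomial : MvPolynomial (LieIndex F V) F →ₗ[F] TensorAlgebra F V :=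
  (monomialBasis F (LieIndex F V)).constr F sortedProd

theorem ofPolynomial_monomial (S : Multiset (LieIndex F V)) :
    ofPolynomial F V (S.map MvPolynomial.X).prod = sortedProd S := by
  rw [← monomialBasis_apply, ofPolynomial, Module.Basis.constr_basis]

variable (F V) in
/-- The elements of the Lie power `L^{n+1}(V)` as linear polynomials. -/
noncomputable def piecePolynomial (n : ℕ) :
    liePiece F V (n + 1) →ₗ[F] MvPolynomial (LieIndex F V) F :=
  (pieceBasis F V n).constr F fun k => MvPolynomial.X ⟨n, k⟩

theorem piecePolynomial_basis (i : LieIndex F V) :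
    piecePolynomial F V i.1 (pieceBasis F V i.1 i.2) = MvPolynomial.X i := by
  rw [piecePolynomial, Module.Basis.constr_basis]

/-- Up to products with merged factors, `ofPolynomial` maps a product of homogeneous Lie elements to
their product in the tensor algebra, in any order. -/
theorem ofPolynomial_prod_sub_mem (l : List (Σ n, liePiece F V (n + 1))) {Q : Set (Multiset ℕ)}
    (hQ : MergesInto (l.map fun p => p.1 + 1 : List ℕ) Q) :
    ofPolynomial F V (l.map fun p => piecePolynomial F V p.1 p.2).prod -
      (l.map fun p => TensorPower.toTensorAlgebra (p.2 : ⨂[F]^(p.1 + 1) V)).prod ∈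
        lieProducts F V Q := by
  -- The factors are expanded in the basis one after the other; `l₀` lists those already expanded.
  suffices H : ∀ (l : List (Σ n, liePiece F V (n + 1))) (l₀ : List (LieIndex F V)),
      MergesInto (l₀.map degree ++ l.map fun p => p.1 + 1 : List ℕ) Q →
      ofPolynomial F V ((l₀.map MvPolynomial.X).prod *
        (l.map fun p => piecePolynomial F V p.1 p.2).prod) -
      (l₀.map fun i => (lieBasis F V i : TensorAlgebra F V)).prod *
        (l.map fun p => TensorPower.toTensorAlgebra (p.2 : ⨂[F]^(p.1 + 1) V)).prod ∈
        lieProducts F V Q by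
    simpa using H l [] hQ
  intro l
  induction l with
  | nil =>
    intro l₀ hQ
    rw [List.map_nil, List.append_nil] at hQ
    simp only [List.map_nil, List.prod_nil, mul_one]
    rw [← Multiset.prod_coe, ← Multiset.map_coe, ofPolynomial_monomial, ← neg_sub]
    exact neg_mem (prod_sub_sortedProd_mem l₀ hQ)
  | cons p l ih =>
    obtain ⟨n, x⟩ := p
    intro l₀ hQ
    simp only [List.map_cons, List.prod_cons]
    induction x using basis_induction (pieceBasis F V n) with
    | zero => simp
    | add x y hx hy =>
      simp only [map_add, Submodule.coe_add, add_mul, mul_add, add_sub_add_comm]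
      exact add_mem (hx hQ) (hy hQ)
    | smul c x hx =>
      simp only [map_smul, Submodule.coe_smul, smul_mul_assoc, mul_smul_comm, ← smul_sub]
      exact Submodule.smul_mem _ _ (hx hQ)
    | basis k =>
      have h := ih (l₀ ++ [⟨n, k⟩]) (by simpa [degree] using hQ)
      simp only [List.map_append, List.prod_append, List.map_cons, List.map_nil, List.prod_cons,
        List.prod_nil, mul_one, mul_assoc, coe_lieBasis ⟨n, k⟩] at h
      rw [piecePolynomial_basis ⟨n, k⟩]
      exact h

end Graded

section HigherLieModule

variable {F : Type*} [Field F] {G : Type*} [Group G] {V : Type*} [AddCommGroup V] [Module F V]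
  (ρ : Representation F G V)

/-- The algebra homomorphism from the symmetric algebra of `L^{n+1}(V)` to the polynomials in the
basis elements of the free Lie algebra. -/
noncomputable def symPolynomial (n : ℕ) :
    SymmetricAlgebra F (liePower ρ (n + 1)).toSubmodule →ₐ[F] MvPolynomial (LieIndex F V) F :=
  SymmetricAlgebra.lift (piecePolynomial F V n)

theorem symPolynomial_ι (n : ℕ) (x : (liePower ρ (n + 1)).toSubmodule) :
    symPolynomial ρ n (SymmetricAlgebra.ι F _ x) = piecePolynomial F V n x :=
  SymmetricAlgebra.lift_ι_apply _ _

variable {r : ℕ} (μ : r.Partition)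

/-- The product of the elements of a list in the symmetric power. -/
noncomputable def symProd {W : Type*} [AddCommGroup W] [Module F W] {τ : Representation F G W}
    {m : ℕ} (l : List W) (hl : l.length = m) : (symPower τ m).toSubmodule :=
  ⟨(l.map (SymmetricAlgebra.ι F W)).prod, by
    subst hl
    change _ ∈ LinearMap.range (SymmetricAlgebra.ι F W) ^ l.length
    induction l with
    | nil => simp
    | cons x l ih =>
      rw [List.map_cons, List.prod_cons, List.length_cons, pow_succ']
      exact Submodule.mul_mem_mul ⟨x, rfl⟩ ih⟩

theorem symPower_apply_symProd {W : Type*} [AddCommGroup W] [Module F W] {τ : Representation F G W}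
    {m : ℕ} (l : List W) (hl : l.length = m) (g : G) :
    (symPower τ m).toRepresentation g (symProd l hl) =
      symProd (l.map (τ g)) ((List.length_map _).trans hl) := by
  refine Subtype.ext ?_
  change SymmetricAlgebra.lift (SymmetricAlgebra.ι F W ∘ₗ τ g)
    (l.map (SymmetricAlgebra.ι F W)).prod = ((l.map (τ g)).map (SymmetricAlgebra.ι F W)).prod
  rw [map_list_prod, List.map_map, List.map_map]
  congr 2
  funext x
  simp

/-- The monomials of degree `m` in a basis of `W` form a basis of `S^m(W)`. -/
theorem exists_symPower_basis {W κ : Type*} [AddCommGroup W] [Module F W]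
    (τ : Representation F G W) (m : ℕ) (β : Module.Basis κ F W) :
    ∃ b : Module.Basis {s : Multiset κ // s.card = m} F (symPower τ m).toSubmodule,
      ∀ s, b s = symProd (s.1.toList.map β) (by simp [s.2]) := by
  let v : {s : Multiset κ // s.card = m} → SymmetricAlgebra F W :=
    fun s => (s.1.map fun k => SymmetricAlgebra.ι F W (β k)).prod
  have hli : LinearIndependent F v := by
    let f : SymmetricAlgebra F W →ₐ[F] MvPolynomial κ F :=
      SymmetricAlgebra.lift (β.constr F MvPolynomial.X)
    refine LinearIndependent.of_comp f.toLinearMap ?_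
    have h : f.toLinearMap ∘ v = monomialBasis F κ ∘ Subtype.val := by
      funext s
      rw [Function.comp_apply, Function.comp_apply, monomialBasis_apply]
      simp [v, f, map_multiset_prod, Module.Basis.constr_basis]
    rw [h]
    exact (monomialBasis F κ).linearIndependent.comp _ Subtype.val_injective
  have hspan : Submodule.span F (Set.range v) = (symPower τ m).toSubmodule := by
    change _ = LinearMap.range (SymmetricAlgebra.ι F W) ^ m
    rw [LinearMap.range_eq_map, ← β.span_eq, Submodule.map_span, ← Set.range_comp,
      Submodule.span_pow]
    congr 1
    ext a
    rw [Set.mem_pow]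
    constructor
    · rintro ⟨⟨s, hs⟩, rfl⟩
      subst hs
      induction s using Quotient.inductionOn with | _ l =>
      refine ⟨fun i => ⟨_, ⟨l.get i, rfl⟩⟩, ?_⟩
      change _ = (Multiset.map _ (l : Multiset κ)).prod
      rw [Multiset.map_coe, Multiset.prod_coe]
      congr 1
      conv_rhs => rw [← List.ofFn_get l, List.map_ofFn]
      rfl
    · rintro ⟨f, rfl⟩
      choose k hk using fun i => (f i).2
      refine ⟨⟨(List.ofFn k : Multiset κ), by simp⟩, ?_⟩
      simp only [v, Multiset.map_coe, Multiset.prod_coe, List.map_ofFn]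
      congr 2
      funext i
      exact hk i
  refine ⟨(Module.Basis.span hli).map (LinearEquiv.ofEq _ _ hspan), fun s => Subtype.ext ?_⟩
  rw [Module.Basis.map_apply, LinearEquiv.coe_ofEq_apply, Module.Basis.span_apply]
  change (s.1.map fun k => SymmetricAlgebra.ι F W (β k)).prod =
    ((s.1.toList.map β).map (SymmetricAlgebra.ι F W)).prod
  rw [List.map_map]
  conv_lhs => rw [← s.1.coe_toList, Multiset.map_coe, Multiset.prod_coe]
  rfl

/-- The space underlying the higher Lie module `L^μ(V)`. -/
abbrev HigherLieSpace : Type _ := ⨂[F] i : Fin r, (lieFactor ρ μ ((i : ℕ) + 1)).toSubmodule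

/-- The higher Lie module as a space of polynomials in the basis elements of the free Lie
algebra. -/
noncomputable def higherLiePolynomial :
    HigherLieSpace ρ μ →ₗ[F] MvPolynomial (LieIndex F V) F :=
  PiTensorProduct.lift
    ((MultilinearMap.mkPiAlgebra F (Fin r) (MvPolynomial (LieIndex F V) F)).compLinearMap
      fun i => (symPolynomial ρ (i : ℕ)).toLinearMap ∘ₗ
        (lieFactor ρ μ ((i : ℕ) + 1)).toSubmodule.subtype)

/-- An element of the Lie power `L^{n+1}(V)`, together with its degree minus one. -/
def gradedFactor (n : ℕ) (x : (liePower ρ (n + 1)).toSubmodule) : Σ n, liePiece F V (n + 1) :=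
  ⟨n, ⟨x.1, x.2⟩⟩

/-- The list of all factors of a family of products, with their degrees minus one. -/
def flatFactors (w : ∀ i : Fin r, List (liePower ρ ((i : ℕ) + 1)).toSubmodule) :
    List (Σ n, liePiece F V (n + 1)) :=
  (List.finRange r).flatMap fun i => (w i).map (gradedFactor ρ i)

theorem higherLiePolynomial_tprod
    (w : ∀ i : Fin r, List (liePower ρ ((i : ℕ) + 1)).toSubmodule)
    (hw : ∀ i, (w i).length = μ.parts.count ((i : ℕ) + 1)) :
    higherLiePolynomial ρ μ (PiTensorProduct.tprod F fun i => symProd (w i) (hw i)) =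
      ∏ i, (((w i).map (gradedFactor ρ i)).map fun p => piecePolynomial F V p.1 p.2).prod := by
  rw [higherLiePolynomial, PiTensorProduct.lift.tprod, MultilinearMap.compLinearMap_apply,
    MultilinearMap.mkPiAlgebra_apply]
  refine Finset.prod_congr rfl fun i _ => ?_
  change symPolynomial ρ i ((w i).map (SymmetricAlgebra.ι F _)).prod = _
  rw [map_list_prod, List.map_map, List.map_map]
  congr 2
  funext x
  exact symPolynomial_ι ρ i x

theorem higherLiePolynomial_tprod_symProd
    (w : ∀ i : Fin r, List (liePower ρ ((i : ℕ) + 1)).toSubmodule)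
    (hw : ∀ i, (w i).length = μ.parts.count ((i : ℕ) + 1)) :
    higherLiePolynomial ρ μ (PiTensorProduct.tprod F fun i => symProd (w i) (hw i)) =
      ((flatFactors ρ w).map fun p => piecePolynomial F V p.1 p.2).prod := by
  rw [higherLiePolynomial_tprod, flatFactors, List.map_flatMap, List.flatMap_def,
    List.prod_flatten, List.map_map, Fin.prod_univ_def]
  rfl

theorem sum_replicate_count :
    ∑ i : Fin r, Multiset.replicate (μ.parts.count ((i : ℕ) + 1)) ((i : ℕ) + 1) = μ.parts := by
  ext a
  rw [Multiset.count_sum']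
  simp only [Multiset.count_replicate]
  by_cases ha : a ∈ μ.parts
  · have h1 := μ.parts_pos ha
    have h2 : a ≤ r := by
      rw [← μ.parts_sum]
      exact Multiset.single_le_sum (fun _ _ => Nat.zero_le _) _ ha
    rw [Finset.sum_eq_single ⟨a - 1, by omega⟩]
    · rw [if_pos (by simp only; omega)]
      congr 1
      simp only
      omega
    · intro i _ hi
      rw [if_neg]
      intro h
      exact hi (Fin.ext (by simp only; omega))
    · simp
  · rw [Multiset.count_eq_zero_of_notMem ha]
    refine Finset.sum_eq_zero fun i _ => ?_
    split_ifs with h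
    · rw [h]
      exact Multiset.count_eq_zero_of_notMem ha
    · rfl

theorem coe_flatMap_eq_sum {α β : Type*} (l : List α) (f : α → List β) :
    (l.flatMap f : Multiset β) = (l.map fun a => (f a : Multiset β)).sum := by
  induction l with
  | nil => rfl
  | cons a l ih => rw [List.flatMap_cons, ← Multiset.coe_add, ih, List.map_cons, List.sum_cons]

theorem degrees_flatFactors (w : ∀ i : Fin r, List (liePower ρ ((i : ℕ) + 1)).toSubmodule)
    (hw : ∀ i, (w i).length = μ.parts.count ((i : ℕ) + 1)) :
    (((flatFactors ρ w).map fun p => p.1 + 1 : List ℕ) : Multiset ℕ) = μ.parts := by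
  conv_rhs => rw [← sum_replicate_count μ]
  rw [flatFactors, List.map_flatMap, coe_flatMap_eq_sum, Fin.sum_univ_def]
  congr 2
  funext i
  rw [List.map_map, ← hw i, ← Multiset.coe_replicate, Multiset.coe_eq_coe]
  refine .of_eq ?_
  change List.map (fun _ => (i : ℕ) + 1) (w i) = _
  exact List.map_const'

variable (F V) in
/-- The linear map from the higher Lie module to the tensor algebra which multiplies the chosen
basis elements of the free Lie algebra in increasing order. It depends on the chosen basis, and it
is a homomorphism of representations only up to products with merged factors. -/
noncomputable def higherLieMap : HigherLieSpace ρ μ →ₗ[F] TensorAlgebra F V :=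
  ofPolynomial F V ∘ₗ higherLiePolynomial ρ μ

/-- Up to products with merged factors, `higherLieMap` maps a tensor product of products of Lie
elements to their product in the tensor algebra. -/
theorem higherLieMap_sub_mem {Q : Set (Multiset ℕ)} (hQ : MergesInto μ.parts Q)
    (w : ∀ i : Fin r, List (liePower ρ ((i : ℕ) + 1)).toSubmodule)
    (hw : ∀ i, (w i).length = μ.parts.count ((i : ℕ) + 1)) :
    higherLieMap F V ρ μ (PiTensorProduct.tprod F fun i => symProd (w i) (hw i)) -
      ((flatFactors ρ w).map fun p =>
        TensorPower.toTensorAlgebra (p.2 : ⨂[F]^(p.1 + 1) V)).prod ∈ lieProducts F V Q := by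
  rw [higherLieMap, LinearMap.comp_apply, higherLiePolynomial_tprod_symProd]
  refine ofPolynomial_prod_sub_mem _ ?_
  rwa [degrees_flatFactors ρ μ w hw]

theorem tensorAlgebraMap_mem_component (f : V →ₗ[F] V) {n : ℕ} {a : TensorAlgebra F V}
    (ha : a ∈ component F V n) : tensorAlgebraMap f a ∈ component F V n := by
  have h : (component F V n).map (tensorAlgebraMap f).toLinearMap ≤ component F V n := by
    rw [component, Submodule.map_pow]
    refine pow_le_pow_left' ?_ n
    rintro _ ⟨_, ⟨v, rfl⟩, rfl⟩
    exact ⟨f v, by simp [tensorAlgebraMap]⟩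
  exact h ⟨a, ha, rfl⟩

theorem tensorAlgebraMap_mem_lieProducts (f : V →ₗ[F] V) {Q : Set (Multiset ℕ)}
    {a : TensorAlgebra F V} (ha : a ∈ lieProducts F V Q) :
    tensorAlgebraMap f a ∈ lieProducts F V Q := by
  induction ha using Submodule.span_induction with
  | zero => rw [map_zero]; exact zero_mem _
  | add a b _ _ ha hb => rw [map_add]; exact add_mem ha hb
  | smul c a _ ha => rw [map_smul]; exact Submodule.smul_mem _ _ ha
  | mem a h =>
    obtain ⟨l, hl, hlQ, rfl⟩ := h
    have h1 : tensorAlgebraMap f (l.map Prod.snd).prod =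
        ((l.map fun p => (p.1, tensorAlgebraMap f p.2)).map Prod.snd).prod := by
      rw [map_list_prod, List.map_map, List.map_map]
      rfl
    rw [h1]
    refine prod_mem_lieProducts ?_ ?_
    · intro p hp
      obtain ⟨q, hq, rfl⟩ := List.mem_map.mp hp
      exact ⟨tensorAlgebraMap_mem f (hl q hq).1, tensorAlgebraMap_mem_component f (hl q hq).2⟩
    · rwa [List.map_map, show Prod.fst ∘ (fun p : ℕ × TensorAlgebra F V =>
        (p.1, tensorAlgebraMap f p.2)) = Prod.fst from rfl]

theorem toTensorAlgebra_gradedFactor (g : G) (n : ℕ) (x : (liePower ρ (n + 1)).toSubmodule) :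
    TensorPower.toTensorAlgebra
        (gradedFactor ρ n ((liePower ρ (n + 1)).toRepresentation g x)).2.1 =
      tensorAlgebraMap (ρ g) (TensorPower.toTensorAlgebra (gradedFactor ρ n x).2.1) :=
  toTensorAlgebra_tensorRep ρ (n + 1) g x.1

theorem prod_flatFactors_map (g : G)
    (w : ∀ i : Fin r, List (liePower ρ ((i : ℕ) + 1)).toSubmodule) :
    ((flatFactors ρ fun i => (w i).map ((liePower ρ ((i : ℕ) + 1)).toRepresentation g)).map fun p =>
        TensorPower.toTensorAlgebra (p.2 : ⨂[F]^(p.1 + 1) V)).prod =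
      tensorAlgebraMap (ρ g) ((flatFactors ρ w).map fun p =>
        TensorPower.toTensorAlgebra (p.2 : ⨂[F]^(p.1 + 1) V)).prod := by
  rw [map_list_prod, List.map_map]
  congr 1
  rw [flatFactors, flatFactors, List.map_flatMap, List.map_flatMap]
  congr 1
  funext i
  rw [List.map_map, List.map_map, List.map_map]
  congr 1
  funext x
  exact toTensorAlgebra_gradedFactor ρ g i x

/-- The multisets of basis elements whose degrees form the partition `μ`. -/
abbrev PartitionFamily : Type _ :=
  ∀ i : Fin r, {s : Multiset (Module.Basis.ofVectorSpaceIndex F (liePiece F V ((i : ℕ) + 1))) //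
    s.card = μ.parts.count ((i : ℕ) + 1)}

variable (F V) in
/-- The union of a family of multisets of basis elements of the Lie powers. -/
def PartitionFamily.union (s : PartitionFamily (F := F) (V := V) μ) : Multiset (LieIndex F V) :=
  sigmaUnion fun i => (s i).1

/-- The chosen basis of the Lie power `L^{n+1}(V)` as a representation. -/
noncomputable def liePowerBasis (n : ℕ) :
    Module.Basis (Module.Basis.ofVectorSpaceIndex F (liePiece F V (n + 1))) F
      (liePower ρ (n + 1)).toSubmodule :=
  pieceBasis F V n

theorem exists_higherLie_basis :
    ∃ b : Module.Basis (PartitionFamily (F := F) (V := V) μ) F (HigherLieSpace ρ μ),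
      (∀ s, ∃ (w : ∀ i : Fin r, List (liePower ρ ((i : ℕ) + 1)).toSubmodule)
        (hw : ∀ i, (w i).length = μ.parts.count ((i : ℕ) + 1)),
          b s = PiTensorProduct.tprod F fun i => symProd (w i) (hw i)) ∧
      ∀ s, higherLieMap F V ρ μ (b s) = sortedProd (PartitionFamily.union F V μ s) := by
  choose β hβ using fun i : Fin r => exists_symPower_basis
    (liePower ρ ((i : ℕ) + 1)).toRepresentation (μ.parts.count ((i : ℕ) + 1))
    (liePowerBasis ρ i)
  refine ⟨Basis.piTensorProduct β, fun s => ?_, fun s => ?_⟩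
  · refine ⟨fun i => (s i).1.toList.map (liePowerBasis ρ i),
      fun i => by dsimp only; rw [List.length_map, Multiset.length_toList, (s i).2], ?_⟩
    rw [Basis.piTensorProduct_apply]
    congr 1
    funext i
    exact hβ i (s i)
  · rw [Basis.piTensorProduct_apply]
    simp only [hβ]
    rw [higherLieMap, LinearMap.comp_apply, higherLiePolynomial_tprod, ← ofPolynomial_monomial,
      PartitionFamily.union, sigmaUnion, ← Multiset.coe_mapAddMonoidHom, map_sum, Multiset.prod_sum]
    congr 1
    refine Finset.prod_congr rfl fun i _ => ?_
    rw [Multiset.coe_mapAddMonoidHom, Multiset.map_map, List.map_map, List.map_map]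
    conv_rhs => rw [← (s i).1.coe_toList, Multiset.map_coe, Multiset.prod_coe]
    congr 2
    funext k
    exact piecePolynomial_basis ⟨i, k⟩

theorem union_injective : Function.Injective (PartitionFamily.union F V μ) := by
  intro s t hst
  funext i
  exact Subtype.ext (congrFun (sigmaUnion_injective hst) i)

theorem map_degree_union (s : PartitionFamily (F := F) (V := V) μ) :
    (PartitionFamily.union F V μ s).map degree = μ.parts := by
  rw [PartitionFamily.union, sigmaUnion, ← Multiset.coe_mapAddMonoidHom, map_sum]
  conv_rhs => rw [← sum_replicate_count μ]
  refine Finset.sum_congr rfl fun i _ => ?_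
  rw [Multiset.coe_mapAddMonoidHom, Multiset.map_map]
  change (s i).1.map (fun _ => (i : ℕ) + 1) = _
  exact (Multiset.map_const' _ _).trans
    (congrArg (fun n => Multiset.replicate n ((i : ℕ) + 1)) (s i).2)

theorem exists_union_eq {S : Multiset (LieIndex F V)} (hS : S.map degree = μ.parts) :
    ∃ s, PartitionFamily.union F V μ s = S := by
  obtain ⟨t, rfl⟩ := exists_sigmaUnion_eq (r := r) fun x hx => by
    have h1 : degree x ∈ μ.parts := hS ▸ Multiset.mem_map_of_mem degree hx
    have h2 := Multiset.single_le_sum (fun _ _ => Nat.zero_le _) _ h1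
    rw [μ.parts_sum, degree] at h2
    exact h2
  refine ⟨fun i => ⟨t i, ?_⟩, rfl⟩
  rw [← hS, sigmaUnion, ← Multiset.coe_mapAddMonoidHom, map_sum, Multiset.count_sum',
    Finset.sum_eq_single i]
  · rw [Multiset.coe_mapAddMonoidHom, Multiset.map_map]
    exact (Multiset.count_replicate_self _ _).symm.trans
      (congrArg (Multiset.count _) (Multiset.map_const' (t i) ((i : ℕ) + 1)).symm)
  · intro j _ hji
    rw [Multiset.coe_mapAddMonoidHom, Multiset.map_map, Multiset.count_eq_zero]
    intro h
    obtain ⟨k, -, hk⟩ := Multiset.mem_map.mp h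
    exact hji (Fin.ext (Nat.succ_injective hk))
  · simp

theorem higherLieMap_mem (x : HigherLieSpace ρ μ) :
    higherLieMap F V ρ μ x ∈ lieProducts F V {μ.parts} := by
  obtain ⟨b, -, hb⟩ := exists_higherLie_basis ρ μ
  induction x using basis_induction b with
  | zero => rw [map_zero]; exact zero_mem _
  | add x y hx hy => rw [map_add]; exact add_mem hx hy
  | smul c x hx => rw [map_smul]; exact Submodule.smul_mem _ _ hx
  | basis s =>
    rw [hb]
    exact sortedProd_mem_lieProducts (map_degree_union μ s)

theorem higherLie_tprod_symProd (g : G)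
    (w : ∀ i : Fin r, List (liePower ρ ((i : ℕ) + 1)).toSubmodule)
    (hw : ∀ i, (w i).length = μ.parts.count ((i : ℕ) + 1)) :
    higherLie ρ μ g (PiTensorProduct.tprod F fun i => symProd (w i) (hw i)) =
      PiTensorProduct.tprod F fun i =>
        symProd ((w i).map ((liePower ρ ((i : ℕ) + 1)).toRepresentation g))
          ((List.length_map _).trans (hw i)) := by
  change PiTensorProduct.map _ _ = _
  rw [PiTensorProduct.map_tprod]
  congr 1
  funext i
  exact symPower_apply_symProd (w i) (hw i) g

theorem higherLieMap_higherLie_tprod_sub_mem {Q : Set (Multiset ℕ)} (hQ : MergesInto μ.parts Q)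
    (g : G) (w : ∀ i : Fin r, List (liePower ρ ((i : ℕ) + 1)).toSubmodule)
    (hw : ∀ i, (w i).length = μ.parts.count ((i : ℕ) + 1)) :
    higherLieMap F V ρ μ
        (higherLie ρ μ g (PiTensorProduct.tprod F fun i => symProd (w i) (hw i))) -
      tensorAlgebraMap (ρ g)
        (higherLieMap F V ρ μ (PiTensorProduct.tprod F fun i => symProd (w i) (hw i))) ∈
      lieProducts F V Q := by
  rw [higherLie_tprod_symProd]
  have h1 := higherLieMap_sub_mem ρ μ hQ
    (fun i => (w i).map ((liePower ρ ((i : ℕ) + 1)).toRepresentation g))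
    (fun i => (List.length_map _).trans (hw i))
  have h2 := tensorAlgebraMap_mem_lieProducts (ρ g) (higherLieMap_sub_mem ρ μ hQ w hw)
  rw [prod_flatFactors_map] at h1
  rw [map_sub] at h2
  have := sub_mem h1 h2
  rwa [sub_sub_sub_cancel_right] at this

/-- Modulo products with merged factors, `higherLieMap` is a homomorphism of representations. -/
theorem higherLieMap_higherLie_sub_mem {Q : Set (Multiset ℕ)} (hQ : MergesInto μ.parts Q) (g : G)
    (x : HigherLieSpace ρ μ) :
    higherLieMap F V ρ μ (higherLie ρ μ g x) - tensorAlgebraMap (ρ g) (higherLieMap F V ρ μ x) ∈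
      lieProducts F V Q := by
  let D : HigherLieSpace ρ μ →ₗ[F] TensorAlgebra F V := higherLieMap F V ρ μ ∘ₗ higherLie ρ μ g -
    (tensorAlgebraMap (ρ g)).toLinearMap ∘ₗ higherLieMap F V ρ μ
  suffices h : (⊤ : Submodule F (HigherLieSpace ρ μ)) ≤ (lieProducts F V Q).comap D from
    h Submodule.mem_top
  obtain ⟨b, hb, -⟩ := exists_higherLie_basis ρ μ
  rw [← b.span_eq, Submodule.span_le]
  rintro _ ⟨s, rfl⟩
  obtain ⟨w, hw, h⟩ := hb s
  rw [h]
  exact higherLieMap_higherLie_tprod_sub_mem ρ μ hQ g w hw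

/-- The Poincaré–Birkhoff–Witt theorem: `higherLieMap` is injective modulo the products of Lie
elements with other degrees. -/
theorem eq_zero_of_higherLieMap_mem {Q : Set (Multiset ℕ)} (hpos : ∀ m ∈ Q, ∀ n ∈ m, 0 < n)
    (hQ : ∀ m ∈ Q, MergesInto m Q) (hμ : μ.parts ∉ Q) {x : HigherLieSpace ρ μ}
    (hx : higherLieMap F V ρ μ x ∈ lieProducts F V Q) : x = 0 := by
  obtain ⟨b, -, hb⟩ := exists_higherLie_basis ρ μ
  have hli := linearIndependent_sortedProd F V
  have himage : ∀ x, higherLieMap F V ρ μ x =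
      Finsupp.linearCombination F (sortedProd ∘ PartitionFamily.union F V μ) (b.repr x) := by
    intro x
    conv_lhs => rw [← b.linearCombination_repr x]
    rw [Finsupp.apply_linearCombination]
    congr 2
    funext s
    exact hb s
  have h0 : higherLieMap F V ρ μ x = 0 := by
    rw [lieProducts_eq_span_sortedProd hpos hQ] at hx
    have hx' : higherLieMap F V ρ μ x ∈ Submodule.span F (sortedProd ''
        {S : Multiset (LieIndex F V) | S.map degree = μ.parts}) := by
      rw [himage]
      have h : Finsupp.linearCombination F (sortedProd ∘ PartitionFamily.union F V μ) (b.repr x) ∈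
          Submodule.span F (Set.range (sortedProd ∘ PartitionFamily.union F V μ)) := by
        rw [← Finsupp.range_linearCombination]
        exact ⟨_, rfl⟩
      refine Submodule.span_mono ?_ h
      rintro _ ⟨s, rfl⟩
      exact ⟨_, map_degree_union μ s, rfl⟩
    refine Submodule.disjoint_def.mp (hli.disjoint_span_image ?_) _ hx' hx
    rw [Set.disjoint_left]
    intro S h1 h2
    exact hμ (h1 ▸ h2)
  rw [himage] at h0
  have h1 := hli.comp _ (union_injective (F := F) (V := V) μ)
  rw [linearIndependent_iff] at h1
  exact b.repr.map_eq_zero_iff.mp (h1 _ h0)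

theorem exists_sub_higherLieMap_mem {Q : Set (Multiset ℕ)} (hpos : ∀ m ∈ Q, ∀ n ∈ m, 0 < n)
    (hQ : ∀ m ∈ Q, MergesInto m Q) (hμ : MergesInto μ.parts Q) {a : TensorAlgebra F V}
    (ha : a ∈ lieProducts F V (insert μ.parts Q)) :
    ∃ x, a - higherLieMap F V ρ μ x ∈ lieProducts F V Q := by
  obtain ⟨b, -, hb⟩ := exists_higherLie_basis ρ μ
  rw [lieProducts_eq_span_sortedProd] at ha
  rotate_left
  · rintro m (rfl | hm)
    · exact fun n hn => μ.parts_pos hn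
    · exact hpos m hm
  · rintro m (rfl | hm)
    · exact fun a b t h => Or.inr (hμ a b t h)
    · exact fun a b t h => Or.inr (hQ m hm a b t h)
  induction ha using Submodule.span_induction with
  | zero => exact ⟨0, by simp⟩
  | add a a' _ _ ha ha' =>
    obtain ⟨x, hx⟩ := ha
    obtain ⟨x', hx'⟩ := ha'
    exact ⟨x + x', by rw [map_add, add_sub_add_comm]; exact add_mem hx hx'⟩
  | smul c a _ ha =>
    obtain ⟨x, hx⟩ := ha
    exact ⟨c • x, by rw [map_smul, ← smul_sub]; exact Submodule.smul_mem _ _ hx⟩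
  | mem a h =>
    obtain ⟨S, hS | hS, rfl⟩ := h
    · obtain ⟨s, rfl⟩ := exists_union_eq μ hS
      exact ⟨b s, by rw [hb, sub_self]; exact zero_mem _⟩
    · exact ⟨0, by rw [map_zero, sub_zero]; exact sortedProd_mem_lieProducts hS⟩

end HigherLieModule

/-! ### Merging parts and the lexicographic order -/

section Lexicographic

variable {r : ℕ}

/-- The parts of a partition in non-increasing order. -/
def sortedParts (μ : r.Partition) : List ℕ := μ.parts.sort (· ≥ ·)

theorem lexLT_iff {μ θ : r.Partition} : LexLT μ θ ↔ sortedParts μ < sortedParts θ := Iff.rfl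

theorem sortedParts_injective : Function.Injective (sortedParts : r.Partition → List ℕ) := by
  intro μ θ h
  have := congrArg (fun l : List ℕ => (l : Multiset ℕ)) h
  simp only [sortedParts, Multiset.sort_eq] at this
  exact Nat.Partition.ext this

theorem sort_add_of_le (u v : Multiset ℕ) (h : ∀ a ∈ u, ∀ b ∈ v, b ≤ a) :
    (u + v).sort (· ≥ ·) = u.sort (· ≥ ·) ++ v.sort (· ≥ ·) := by
  refine List.Perm.eq_of_pairwise' ((u + v).pairwise_sort (· ≥ ·)) ?_ ?_
  · rw [List.pairwise_append]
    exact ⟨u.pairwise_sort _, v.pairwise_sort _, fun a ha b hb =>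
      h a ((Multiset.mem_sort _).mp ha) b ((Multiset.mem_sort _).mp hb)⟩
  · rw [← Multiset.coe_eq_coe, ← Multiset.coe_add, Multiset.sort_eq, Multiset.sort_eq,
      Multiset.sort_eq]

/-- Replacing two parts by their sum makes a partition lexicographically larger: the parts which are
at least the sum are the same before, and are followed by a smaller part. -/
theorem sort_lt_sort_merge {a b : ℕ} (ha : 0 < a) (hb : 0 < b) (t : Multiset ℕ) :
    (a ::ₘ b ::ₘ t).sort (· ≥ ·) < ((a + b) ::ₘ t).sort (· ≥ ·) := by
  set u := t.filter (a + b ≤ ·)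
  set v := t.filter fun x => ¬ a + b ≤ x
  have ht : u + v = t := Multiset.filter_add_not _ _
  have hu : ∀ x ∈ u, a + b ≤ x := fun x hx => (Multiset.mem_filter.mp hx).2
  have hv : ∀ x ∈ v, x < a + b := fun x hx => not_le.mp (Multiset.mem_filter.mp hx).2
  have h1 : a ::ₘ b ::ₘ t = u + a ::ₘ b ::ₘ v := by
    rw [← ht, Multiset.add_cons, Multiset.add_cons]
  have h2 : (a + b) ::ₘ t = u + ({a + b} + v) := by
    rw [← ht, Multiset.singleton_add, Multiset.add_cons]
  have h3 : ∀ x ∈ a ::ₘ b ::ₘ v, x < a + b := by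
    intro x hx
    rcases Multiset.mem_cons.mp hx with rfl | hx
    · omega
    rcases Multiset.mem_cons.mp hx with rfl | hx
    · omega
    · exact hv x hx
  rw [h1, h2, sort_add_of_le _ _ fun x hx y hy => (h3 y hy).le.trans (hu x hx),
    sort_add_of_le u, sort_add_of_le {a + b}, Multiset.sort_singleton]
  rotate_left
  · intro x hx y hy
    rw [Multiset.mem_singleton.mp hx]
    exact (hv y hy).le
  · intro x hx y hy
    rcases Multiset.mem_add.mp hy with hy | hy
    · rw [Multiset.mem_singleton.mp hy]
      exact hu x hx
    · exact (hv y hy).le.trans (hu x hx)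
  refine List.Lex.append_left (· < ·) ?_ _
  rcases hl : (a ::ₘ b ::ₘ v).sort (· ≥ ·) with _ | ⟨x, l⟩
  · exact List.Lex.nil
  · refine List.Lex.rel (h3 x ?_)
    rw [← Multiset.mem_sort (· ≥ ·), hl]
    exact List.mem_cons_self

/-- The multisets of parts of the partitions in a set. -/
def partsOf (P : Set r.Partition) : Set (Multiset ℕ) := Nat.Partition.parts '' P

theorem parts_mem_partsOf {P : Set r.Partition} {μ : r.Partition} :
    μ.parts ∈ partsOf P ↔ μ ∈ P := by
  constructor
  · rintro ⟨θ, hθ, h⟩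
    rwa [← Nat.Partition.ext h]
  · exact fun h => ⟨μ, h, rfl⟩

theorem pos_of_mem_partsOf (P : Set r.Partition) : ∀ m ∈ partsOf P, ∀ n ∈ m, 0 < n := by
  rintro _ ⟨μ, -, rfl⟩ n hn
  exact μ.parts_pos hn

theorem partsOf_insert (P : Set r.Partition) (μ : r.Partition) :
    partsOf (insert μ P) = insert μ.parts (partsOf P) :=
  Set.image_insert_eq

theorem mergesInto_partsOf {P : Set r.Partition} {μ : r.Partition}
    (h : ∀ θ, LexLT μ θ → θ ∈ P) : MergesInto μ.parts (partsOf P) := by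
  intro a b t hm
  have ha : 0 < a := μ.parts_pos (by rw [hm]; exact Multiset.mem_cons_self _ _)
  have hb : 0 < b := μ.parts_pos (by
    rw [hm]
    exact Multiset.mem_cons_of_mem (Multiset.mem_cons_self _ _))
  let θ : r.Partition :=
    { parts := (a + b) ::ₘ t
      parts_pos := by
        intro i hi
        rcases Multiset.mem_cons.mp hi with rfl | hi
        · omega
        · exact μ.parts_pos (by
            rw [hm]
            exact Multiset.mem_cons_of_mem (Multiset.mem_cons_of_mem hi))
      parts_sum := by
        have := μ.parts_sum
        rw [hm] at this
        simpa [add_assoc] using this }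
  refine ⟨θ, h θ ?_, rfl⟩
  rw [lexLT_iff, sortedParts, hm]
  exact sort_lt_sort_merge ha hb t

/-- A set of partitions is upward closed in the lexicographic order. -/
def IsLexUpper (P : Set r.Partition) : Prop := ∀ μ ∈ P, ∀ θ, LexLT μ θ → θ ∈ P

theorem IsLexUpper.mergesInto {P : Set r.Partition} (hP : IsLexUpper P) :
    ∀ m ∈ partsOf P, MergesInto m (partsOf P) := by
  rintro _ ⟨μ, hμ, rfl⟩
  exact mergesInto_partsOf (hP μ hμ)

end Lexicographic

/-! ### The lexicographic filtration of the tensor power -/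

section LexFiltration

variable {F : Type*} [Field F] {V : Type*} [AddCommGroup V] [Module F V] {r : ℕ}

/-- On products of Lie elements whose degrees form the cycle type of `σ`, the convolution operator
of `ν` acts as the value at `σ` of the Young character of `ν`. -/
theorem convolution_sub_youngCharacter_smul_mem (ν : Composition r) (σ : Equiv.Perm (Fin r))
    {Q : Set (Multiset ℕ)} (hQ : ∀ m ∈ Q, MergesInto m Q) (hσ : MergesInto (cycleShape σ).parts Q)
    {a : TensorAlgebra F V} (ha : a ∈ lieProducts F V (insert (cycleShape σ).parts Q)) :
    convolution F V ν a - (youngCharacter ν σ : F) • a ∈ lieProducts F V Q := by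
  induction ha using Submodule.span_induction with
  | zero => rw [map_zero, smul_zero, sub_zero]; exact zero_mem _
  | add a b _ _ ha hb => rw [map_add, smul_add, add_sub_add_comm]; exact add_mem ha hb
  | smul c a _ ha =>
    rw [map_smul, smul_comm, ← smul_sub]
    exact Submodule.smul_mem _ _ ha
  | mem a h =>
    obtain ⟨l, hl, hlQ, rfl⟩ := h
    rcases hlQ with hlQ | hlQ
    · rw [youngCharacter_eq_card ν σ fun i => (l.get i).1]
      · exact convolution_sub_smul_mem ν hl (hlQ ▸ hσ)
      · rw [← hlQ, Fin.univ_def]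
        change (((List.finRange l.length).map fun i => (l.get i).1 : List ℕ) : Multiset ℕ) = _
        rw [← List.ofFn_eq_map]
        congr 1
        conv_rhs => rw [← List.ofFn_get l, List.map_ofFn]
        rfl
    · have h := convolution_sub_smul_mem ν hl (hQ _ hlQ)
      have h2 := prod_mem_lieProducts hl hlQ
      exact sub_mem (sub_add_cancel (convolution F V ν (l.map Prod.snd).prod) _ ▸
        add_mem h (Submodule.smul_mem _ _ h2)) (Submodule.smul_mem _ _ h2)

theorem convolution_mem (ν : Composition r) {Q : Set (Multiset ℕ)}
    (hQ : ∀ m ∈ Q, MergesInto m Q) {a : TensorAlgebra F V} (ha : a ∈ lieProducts F V Q) :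
    convolution F V ν a ∈ lieProducts F V Q := by
  induction ha using Submodule.span_induction with
  | zero => rw [map_zero]; exact zero_mem _
  | add a b _ _ ha hb => rw [map_add]; exact add_mem ha hb
  | smul c a _ ha => rw [map_smul]; exact Submodule.smul_mem _ _ ha
  | mem a h =>
    obtain ⟨l, hl, hlQ, rfl⟩ := h
    rw [← sub_add_cancel (convolution F V ν (l.map Prod.snd).prod)]
    exact add_mem (convolution_sub_smul_mem ν hl (hQ _ hlQ))
      (Submodule.smul_mem _ _ (prod_mem_lieProducts hl hlQ))

variable (F V) in
/-- The subspace of `T^r(V)` spanned by the products of homogeneous Lie elements whose degrees form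
a partition in `P`. -/
noncomputable def lexSubmodule (P : Set r.Partition) : Submodule F (⨂[F]^r V) :=
  (lieProducts F V (partsOf P)).comap TensorPower.toTensorAlgebra

theorem mem_lexSubmodule {P : Set r.Partition} {t : ⨂[F]^r V} :
    t ∈ lexSubmodule F V P ↔ TensorPower.toTensorAlgebra t ∈ lieProducts F V (partsOf P) :=
  Iff.rfl

theorem lexSubmodule_mono {P P' : Set r.Partition} (h : P ⊆ P') :
    lexSubmodule F V P ≤ lexSubmodule F V P' :=
  Submodule.comap_mono (lieProducts_mono (Set.image_mono h))

theorem lexSubmodule_univ : lexSubmodule F V (Set.univ : Set r.Partition) = ⊤ := by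
  rw [eq_top_iff, ← PiTensorProduct.span_tprod_eq_top, Submodule.span_le]
  rintro _ ⟨v, rfl⟩
  rw [SetLike.mem_coe, mem_lexSubmodule, TensorPower.toTensorAlgebra_tprod,
    TensorAlgebra.tprod_apply]
  have h : (List.ofFn fun i => TensorAlgebra.ι F (v i)) =
      (List.ofFn fun i => ((1 : ℕ), TensorAlgebra.ι F (v i))).map Prod.snd := by
    rw [List.map_ofFn]
    rfl
  rw [h]
  refine prod_mem_lieProducts ?_
    ⟨Nat.Partition.mk (Multiset.replicate r 1) ?_ (by simp), trivial, ?_⟩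
  · intro p hp
    obtain ⟨i, rfl⟩ := List.mem_ofFn.mp hp
    refine ⟨LieSubalgebra.subset_lieSpan ⟨v i, rfl⟩, ?_⟩
    rw [component, pow_one]
    exact ⟨v i, rfl⟩
  · intro i hi
    rw [Multiset.eq_of_mem_replicate hi]
    exact one_pos
  · rw [List.map_ofFn]
    change Multiset.replicate r 1 = ((List.ofFn fun _ : Fin r => 1 : List ℕ) : Multiset ℕ)
    rw [List.ofFn_const, Multiset.coe_replicate]

theorem lexSubmodule_empty : lexSubmodule F V (∅ : Set r.Partition) = ⊥ := by
  rw [lexSubmodule, partsOf, Set.image_empty, lieProducts_empty, Submodule.comap_bot,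
    LinearMap.ker_eq_bot]
  exact toTensorAlgebra_injective r

theorem placeRep_mem_lexSubmodule {P : Set r.Partition} (hP : IsLexUpper P)
    {x : MonoidAlgebra F (Equiv.Perm (Fin r))ᵐᵒᵖ} (hx : x ∈ descentAlgebra F r) {t : ⨂[F]^r V}
    (ht : t ∈ lexSubmodule F V P) :
    (placeRep F V r).asAlgebraHom x t ∈ lexSubmodule F V P := by
  induction hx using Submodule.span_induction with
  | zero => rw [map_zero]; exact zero_mem _
  | add x y _ _ hx hy => rw [map_add]; exact add_mem hx hy
  | smul c x _ hx => rw [map_smul]; exact Submodule.smul_mem _ _ hx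
  | mem x h =>
    obtain ⟨ν, rfl⟩ := h
    rw [mem_lexSubmodule, toTensorAlgebra_descentElt]
    exact convolution_mem ν hP.mergesInto ht

/-- The elements of the descent algebra act on the factors of the lexicographic filtration as
scalars, which are the values of Solomon's map. -/
theorem placeRep_sub_solomonMap_smul_mem {P : Set r.Partition} (hP : IsLexUpper P)
    (σ : Equiv.Perm (Fin r)) (hσ : ∀ θ, LexLT (cycleShape σ) θ → θ ∈ P)
    {x : MonoidAlgebra F (Equiv.Perm (Fin r))ᵐᵒᵖ} (hx : x ∈ descentAlgebra F r) {t : ⨂[F]^r V}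
    (ht : t ∈ lexSubmodule F V (insert (cycleShape σ) P)) :
    (placeRep F V r).asAlgebraHom x t - solomonMap F r ⟨x, hx⟩ σ • t ∈ lexSubmodule F V P := by
  suffices H : ∀ y : descentAlgebra F r, (placeRep F V r).asAlgebraHom (y : MonoidAlgebra F _) t -
      solomonMap F r y σ • t ∈ lexSubmodule F V P from H ⟨x, hx⟩
  intro y
  induction y using basis_induction (descentBasis F r) with
  | zero =>
    rw [map_zero, Submodule.coe_zero, map_zero, LinearMap.zero_apply, Pi.zero_apply, zero_smul,
      sub_zero]
    exact zero_mem _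
  | add x y h h' =>
    rw [map_add, Submodule.coe_add, map_add, LinearMap.add_apply, Pi.add_apply, add_smul,
      add_sub_add_comm]
    exact add_mem h h'
  | smul c x h =>
    rw [map_smul, Submodule.coe_smul, map_smul, LinearMap.smul_apply, Pi.smul_apply, smul_eq_mul,
      mul_smul, ← smul_sub]
    exact Submodule.smul_mem _ _ h
  | basis ν =>
    have e : descentBasis F r ν = ⟨descentElt F ν, descentElt_mem F ν⟩ :=
      Module.Basis.span_apply (descentElt_linearIndependent F r) ν
    rw [e, solomonMap_descentElt, mem_lexSubmodule, map_sub, map_smul, toTensorAlgebra_descentElt]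
    refine convolution_sub_youngCharacter_smul_mem ν σ hP.mergesInto (mergesInto_partsOf hσ) ?_
    rw [← partsOf_insert]
    exact ht

/-- If `x` acts as zero on the factors of the filtration between `P'` and `P`, then the elements of
`P` fixed by `x` are in `P'`. -/
theorem mem_lexSubmodule_of_fixed {P P' : Set r.Partition} (hP : IsLexUpper P)
    (hP' : IsLexUpper P') (hPP' : P' ⊆ P) {x : MonoidAlgebra F (Equiv.Perm (Fin r))ᵐᵒᵖ}
    (hx : x ∈ descentAlgebra F r)
    (hzero : ∀ σ, cycleShape σ ∈ P → cycleShape σ ∉ P' → solomonMap F r ⟨x, hx⟩ σ = 0)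
    {t : ⨂[F]^r V} (hfix : (placeRep F V r).asAlgebraHom x t = t)
    (ht : t ∈ lexSubmodule F V P) : t ∈ lexSubmodule F V P' := by
  induction h : (P \ P').ncard using Nat.strong_induction_on generalizing P with
  | _ n ih =>
  rcases (P \ P').eq_empty_or_nonempty with hemp | hne
  · exact lexSubmodule_mono (Set.sdiff_eq_empty.mp hemp) ht
  · -- The least partition `μ` in `P` outside of `P'` is removed from `P`.
    obtain ⟨μ, ⟨hμP, hμP'⟩, hmin⟩ :=
      Set.exists_min_image (P \ P') sortedParts (Set.toFinite _) hne
    obtain ⟨σ, rfl⟩ := exists_cycleShape μ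
    have hup : IsLexUpper (P \ {cycleShape σ}) := by
      rintro θ ⟨hθ, hne⟩ η hη
      refine ⟨hP θ hθ η hη, ?_⟩
      rintro rfl
      by_cases hθ' : θ ∈ P'
      · exact hμP' (hP' θ hθ' _ hη)
      · exact absurd (lexLT_iff.mp hη) (hmin θ ⟨hθ, hθ'⟩).not_gt
    have hins : insert (cycleShape σ) (P \ {cycleShape σ}) = P := Set.insert_sdiff_self_of_mem hμP
    refine ih _ ?_ hup (fun θ hθ => ⟨hPP' hθ, ?_⟩) (fun τ hτ => hzero τ hτ.1) ?_ rfl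
    · rw [← h]
      refine Set.ncard_lt_ncard ?_ (Set.toFinite _)
      refine ⟨fun θ hθ => ⟨hθ.1.1, hθ.2⟩, fun hsub => ?_⟩
      exact (hsub ⟨hμP, hμP'⟩).1.2 rfl
    · rintro rfl
      exact hμP' hθ
    · have := placeRep_sub_solomonMap_smul_mem hup σ (fun θ hθ => ⟨hP _ hμP θ hθ, ?_⟩) hx
        (hins.symm ▸ ht)
      · rwa [hzero σ hμP hμP', zero_smul, sub_zero, hfix] at this
      · rintro rfl
        exact lt_irrefl _ (lexLT_iff.mp hθ)

end LexFiltration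

/-! ### The factors of the summands of the tensor power -/

/-- The ranges of the members of a complete orthogonal family of idempotent endomorphisms form an
internal direct sum decomposition. -/
theorem isInternal_range_of_completeOrthogonalIdempotents {R M ι : Type*} [CommRing R]
    [AddCommGroup M] [Module R M] [Fintype ι] [DecidableEq ι] {E : ι → Module.End R M}
    (hE : CompleteOrthogonalIdempotents E) :
    DirectSum.IsInternal fun i => LinearMap.range (E i) := by
  refine DirectSum.isInternal_submodule_of_iSupIndep_of_iSup_eq_top ?_ ?_
  · intro i
    have h : ⨆ j, ⨆ (_ : j ≠ i), LinearMap.range (E j) ≤ LinearMap.ker (E i) := by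
      refine iSup₂_le fun j hj => ?_
      rintro _ ⟨x, rfl⟩
      rw [LinearMap.mem_ker, ← Module.End.mul_apply, hE.ortho hj.symm, LinearMap.zero_apply]
    refine Disjoint.mono_right h (Submodule.disjoint_def.mpr ?_)
    rintro _ ⟨x, rfl⟩ hx
    rwa [LinearMap.mem_ker, ← Module.End.mul_apply, (hE.idem i).eq] at hx
  · rw [eq_top_iff]
    intro x _
    have h := LinearMap.congr_fun hE.complete x
    rw [Module.End.one_apply, LinearMap.sum_apply] at h
    rw [← h]
    exact sum_mem fun i _ => Submodule.mem_iSup_of_mem i ⟨x, rfl⟩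

section

variable {F : Type*} [Field F] {G : Type*} [Group G]

/-- A linear map to `A` which is a homomorphism modulo `B`, has trivial kernel modulo `B`, and
reaches all of `A` modulo `B` identifies its source with the factor `A / B`. -/
theorem nonempty_factorRep_equiv {H T : Type*} [AddCommMonoid H] [Module F H] [AddCommGroup T]
    [Module F T] {κ : Representation F G H} {τ : Representation F G T} {A B : Subrepresentation τ}
    (f : H →ₗ[F] T) (hA : ∀ x, f x ∈ A.toSubmodule)
    (hequiv : ∀ g x, f (κ g x) - τ g (f x) ∈ B.toSubmodule)
    (hinj : ∀ x, f x ∈ B.toSubmodule → x = 0)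
    (hsurj : ∀ a ∈ A.toSubmodule, ∃ x, a - f x ∈ B.toSubmodule) :
    Nonempty ((factorRep A B).Equiv κ) := by
  let q : H →ₗ[F] A.toSubmodule ⧸ B.toSubmodule.submoduleOf A.toSubmodule :=
    (Submodule.mkQ _) ∘ₗ f.codRestrict A.toSubmodule hA
  have hq : Function.Bijective q := by
    constructor
    · let _ : AddCommGroup H := Module.addCommMonoidToAddCommGroup F
      rw [injective_iff_map_eq_zero]
      intro x hx
      exact hinj x ((Submodule.Quotient.mk_eq_zero (B.toSubmodule.submoduleOf A.toSubmodule)).mp hx)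
    · intro y
      obtain ⟨⟨a, ha⟩, rfl⟩ := Submodule.mkQ_surjective _ y
      obtain ⟨x, hx⟩ := hsurj a ha
      have h : (⟨a, ha⟩ - ⟨f x, hA x⟩ : A.toSubmodule) ∈ B.toSubmodule.submoduleOf A.toSubmodule :=
        hx
      exact ⟨x, ((Submodule.Quotient.eq _).mpr h).symm⟩
  refine ⟨(Representation.Equiv.mk (LinearEquiv.ofBijective q hq) fun g => ?_).symm⟩
  ext x
  exact (Submodule.Quotient.eq _).mpr (hequiv g x)

variable {V : Type*} [AddCommGroup V] [Module F V] (ρ : Representation F G V) {r : ℕ}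

/-- The products of Lie elements whose degrees form a partition in `P`, as a subrepresentation of
the tensor power. -/
noncomputable def lexSubrep (P : Set r.Partition) : Subrepresentation (tensorRep ρ r) where
  toSubmodule := lexSubmodule F V P
  apply_mem_toSubmodule g t ht := by
    rw [mem_lexSubmodule, toTensorAlgebra_tensorRep]
    exact tensorAlgebraMap_mem_lieProducts (ρ g) ht

theorem higherLieMap_mem_range (μ : r.Partition) (x : HigherLieSpace ρ μ) :
    higherLieMap F V ρ μ x ∈
      LinearMap.range (TensorPower.toTensorAlgebra : ⨂[F]^r V →ₗ[F] TensorAlgebra F V) := by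
  have h : lieProducts F V {μ.parts} ≤
      LinearMap.range (TensorPower.toTensorAlgebra : ⨂[F]^r V →ₗ[F] TensorAlgebra F V) := by
    refine Submodule.span_le.mpr ?_
    rintro _ ⟨l, hl, hμ, rfl⟩
    refine exists_toTensorAlgebra_eq ?_
    have hsum : (l.map Prod.fst).sum = r := by
      rw [← Multiset.sum_coe, hμ, μ.parts_sum]
    rw [← hsum]
    clear hsum hμ
    induction l with
    | nil => exact Submodule.one_le.mp (pow_zero _).ge
    | cons p l ih =>
      rw [List.map_cons, List.map_cons, List.prod_cons, List.sum_cons, component, pow_add]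
      exact Submodule.mul_mem_mul (hl p List.mem_cons_self).2
        (ih fun q hq => hl q (List.mem_cons_of_mem _ hq))
  exact h (higherLieMap_mem ρ μ x)

/-- The map `higherLieMap`, with values in the tensor power. -/
noncomputable def higherLieTensor (μ : r.Partition) : HigherLieSpace ρ μ →ₗ[F] ⨂[F]^r V :=
  (LinearEquiv.ofInjective _ (toTensorAlgebra_injective (F := F) (V := V) r)).symm.toLinearMap ∘ₗ
    (higherLieMap F V ρ μ).codRestrict _ (higherLieMap_mem_range ρ μ)

theorem toTensorAlgebra_higherLieTensor (μ : r.Partition) (x : HigherLieSpace ρ μ) :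
    TensorPower.toTensorAlgebra (higherLieTensor ρ μ x) = higherLieMap F V ρ μ x :=
  congrArg Subtype.val ((LinearEquiv.ofInjective _
    (toTensorAlgebra_injective (F := F) (V := V) r)).apply_symm_apply
      ⟨higherLieMap F V ρ μ x, higherLieMap_mem_range ρ μ x⟩)

/-- The partitions which are lexicographically greater than `μ`. -/
def lexAbove (μ : r.Partition) : Set r.Partition := {θ | LexLT μ θ}

theorem isLexUpper_lexAbove (μ : r.Partition) : IsLexUpper (lexAbove μ) :=
  fun _ hθ _ hη => (lexLT_iff.mp hθ).trans (lexLT_iff.mp hη)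

theorem not_mem_lexAbove (μ : r.Partition) : μ ∉ lexAbove μ := fun h => lt_irrefl _ (lexLT_iff.mp h)

theorem mem_insert_lexAbove {μ θ : r.Partition} :
    θ ∈ insert μ (lexAbove μ) ↔ sortedParts μ ≤ sortedParts θ := by
  rw [le_iff_eq_or_lt, Set.mem_insert_iff, sortedParts_injective.eq_iff, eq_comm]
  exact Iff.rfl

theorem higherLieTensor_mem (μ : r.Partition) (y : HigherLieSpace ρ μ) :
    higherLieTensor ρ μ y ∈ lexSubmodule F V (insert μ (lexAbove μ)) := by
  rw [mem_lexSubmodule, toTensorAlgebra_higherLieTensor, partsOf_insert]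
  exact lieProducts_mono (Set.singleton_subset_iff.mpr (Set.mem_insert _ _))
    (higherLieMap_mem ρ μ y)

theorem higherLieTensor_higherLie_sub_mem (μ : r.Partition) (g : G) (y : HigherLieSpace ρ μ) :
    higherLieTensor ρ μ (higherLie ρ μ g y) - tensorRep ρ r g (higherLieTensor ρ μ y) ∈
      lexSubmodule F V (lexAbove μ) := by
  have h : ∀ z : HigherLieSpace ρ μ, TensorPower.toTensorAlgebra
      (higherLieTensor ρ μ z - tensorRep ρ r g (higherLieTensor ρ μ y)) =
      higherLieMap F V ρ μ z - tensorAlgebraMap (ρ g) (higherLieMap F V ρ μ y) := by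
    intro z
    rw [map_sub, toTensorAlgebra_tensorRep, toTensorAlgebra_higherLieTensor ρ μ z,
      toTensorAlgebra_higherLieTensor ρ μ y]
  rw [mem_lexSubmodule, h]
  exact higherLieMap_higherLie_sub_mem ρ μ (mergesInto_partsOf fun _ h => h) g y

theorem eq_zero_of_higherLieTensor_mem (μ : r.Partition) (y : HigherLieSpace ρ μ)
    (hy : higherLieTensor ρ μ y ∈ lexSubmodule F V (lexAbove μ)) : y = 0 := by
  refine eq_zero_of_higherLieMap_mem ρ μ (pos_of_mem_partsOf (lexAbove μ))
    (isLexUpper_lexAbove μ).mergesInto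
    (fun h => not_mem_lexAbove μ (parts_mem_partsOf.mp h)) ?_
  rw [← toTensorAlgebra_higherLieTensor, ← mem_lexSubmodule]
  exact hy

theorem exists_sub_higherLieTensor_mem (μ : r.Partition) {t : ⨂[F]^r V}
    (ht : t ∈ lexSubmodule F V (insert μ (lexAbove μ))) :
    ∃ y, t - higherLieTensor ρ μ y ∈ lexSubmodule F V (lexAbove μ) := by
  rw [mem_lexSubmodule, partsOf_insert] at ht
  obtain ⟨y, hy⟩ := exists_sub_higherLieMap_mem ρ μ (pos_of_mem_partsOf (lexAbove μ))
    (isLexUpper_lexAbove μ).mergesInto (mergesInto_partsOf fun _ h => h) ht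
  refine ⟨y, ?_⟩
  rw [mem_lexSubmodule, map_sub, toTensorAlgebra_higherLieTensor]
  exact hy

/-- If an idempotent `x` of the descent algebra acts as the identity on a factor of the
lexicographic filtration, then it cuts out a copy of this factor. -/
theorem nonempty_factorRep_placeImage_equiv {H : Type*} [AddCommMonoid H] [Module F H]
    {κ : Representation F G H} {P P' : Set r.Partition} (hP : IsLexUpper P)
    (hP' : IsLexUpper P') {x : MonoidAlgebra F (Equiv.Perm (Fin r))ᵐᵒᵖ}
    (hx : x ∈ descentAlgebra F r) (hidem : IsIdempotentElem x)
    (hact : ∀ t ∈ lexSubmodule F V P,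
      (placeRep F V r).asAlgebraHom x t - t ∈ lexSubmodule F V P')
    (f : H →ₗ[F] ⨂[F]^r V) (hf : ∀ y, f y ∈ lexSubmodule F V P)
    (hequiv : ∀ g y, f (κ g y) - tensorRep ρ r g (f y) ∈ lexSubmodule F V P')
    (hinj : ∀ y, f y ∈ lexSubmodule F V P' → y = 0)
    (hsurj : ∀ t ∈ lexSubmodule F V P, ∃ y, t - f y ∈ lexSubmodule F V P') :
    Nonempty ((factorRep (placeImage ρ x ⊓ lexSubrep ρ P)
      (placeImage ρ x ⊓ lexSubrep ρ P')).Equiv κ) := by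
  refine nonempty_factorRep_equiv ((placeRep F V r).asAlgebraHom x ∘ₗ f)
    (fun y => ?_) (fun g y => ?_) (fun y hy => ?_) (fun a ha => ?_)
  · exact ⟨⟨_, rfl⟩, placeRep_mem_lexSubmodule hP hx (hf y)⟩
  · rw [LinearMap.comp_apply, LinearMap.comp_apply, placeRep_comm, ← map_sub]
    exact ⟨⟨_, rfl⟩, placeRep_mem_lexSubmodule hP' hx (hequiv g y)⟩
  · have h := sub_mem hy.2 (hact _ (hf y))
    rw [LinearMap.comp_apply, sub_sub_cancel] at h
    exact hinj y h
  · obtain ⟨⟨t, rfl⟩, ha⟩ := ha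
    obtain ⟨y, hy⟩ := hsurj _ ha
    have h := placeRep_mem_lexSubmodule hP' hx hy
    rw [map_sub, ← Module.End.mul_apply, ← map_mul, hidem.eq] at h
    refine ⟨y, ?_, h⟩
    rw [LinearMap.comp_apply, ← map_sub]
    exact ⟨_, rfl⟩

/-- An idempotent of the descent algebra whose image under Solomon's map takes the value `1` at
the class of `μ` cuts out a copy of the higher Lie module of `μ` from the lexicographic
filtration. -/
theorem nonempty_factorRep_equiv_higherLie {x : MonoidAlgebra F (Equiv.Perm (Fin r))ᵐᵒᵖ}
    (hx : x ∈ descentAlgebra F r) (hidem : IsIdempotentElem x) (μ : r.Partition)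
    (hone : ∀ σ, cycleShape σ = μ → solomonMap F r ⟨x, hx⟩ σ = 1) :
    Nonempty ((factorRep (placeImage ρ x ⊓ lexSubrep ρ (insert μ (lexAbove μ)))
      (placeImage ρ x ⊓ lexSubrep ρ (lexAbove μ))).Equiv (higherLie ρ μ)) := by
  refine nonempty_factorRep_placeImage_equiv ρ ?_ (isLexUpper_lexAbove μ) hx hidem ?_
    (higherLieTensor ρ μ) (higherLieTensor_mem ρ μ) (higherLieTensor_higherLie_sub_mem ρ μ)
    (eq_zero_of_higherLieTensor_mem ρ μ) fun t => exists_sub_higherLieTensor_mem ρ μ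
  · intro θ hθ η hη
    rw [mem_insert_lexAbove] at hθ ⊢
    exact hθ.trans (lexLT_iff.mp hη).le
  · intro t ht
    obtain ⟨σ, rfl⟩ := exists_cycleShape μ
    have h := placeRep_sub_solomonMap_smul_mem (isLexUpper_lexAbove _) σ (fun _ h => h) hx ht
    rwa [hone σ rfl, one_smul] at h

/-- The summand of an idempotent meets two members of the lexicographic filtration in the same
subrepresentation if the image of the idempotent under Solomon's map vanishes between them. -/
theorem placeImage_inf_lexSubrep_eq {P P' : Set r.Partition} (hP : IsLexUpper P)
    (hP' : IsLexUpper P') (hPP' : P' ⊆ P) {x : MonoidAlgebra F (Equiv.Perm (Fin r))ᵐᵒᵖ}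
    (hx : x ∈ descentAlgebra F r) (hidem : IsIdempotentElem x)
    (hzero : ∀ σ, cycleShape σ ∈ P → cycleShape σ ∉ P' → solomonMap F r ⟨x, hx⟩ σ = 0) :
    placeImage ρ x ⊓ lexSubrep ρ P = placeImage ρ x ⊓ lexSubrep ρ P' := by
  refine Subrepresentation.toSubmodule_injective (le_antisymm ?_ ?_)
  · rintro _ ⟨⟨t, rfl⟩, ht⟩
    refine ⟨⟨t, rfl⟩, mem_lexSubmodule_of_fixed hP hP' hPP' hx hzero ?_ ht⟩
    rw [← Module.End.mul_apply, ← map_mul, hidem.eq]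
  · exact inf_le_inf le_rfl (lexSubmodule_mono hPP')

end

end FiltrationTheorem

theorem theorem3p4 {F : Type*} [Field F] (p : ℕ) [Fact p.Prime] [CharP F p]
    {G : Type*} [Group G] {V : Type*} [AddCommGroup V] [Module F V] (ρ : Representation F G V)
    (r : ℕ) (hr : 0 < r)
    (e : FiltrationTheorem.PClass p r → MonoidAlgebra F (Equiv.Perm (Fin r))ᵐᵒᵖ)
    (he : FiltrationTheorem.IsDescentIdempotentFamily e) :
    DirectSum.IsInternal (fun J => (FiltrationTheorem.placeImage ρ (e J)).toSubmodule) ∧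
    ∀ (J : FiltrationTheorem.PClass p r) (s : ℕ) (l : Fin s → r.Partition),
      (∀ i j, i < j → FiltrationTheorem.LexLT (l i) (l j)) →
      (∀ μ, FiltrationTheorem.MemClass μ J ↔ ∃ j, l j = μ) →
      ∃ U : Fin (s + 1) → Subrepresentation (FiltrationTheorem.tensorRep ρ r),
        Antitone U ∧ U 0 = FiltrationTheorem.placeImage ρ (e J) ∧ U (Fin.last s) = ⊥ ∧
        ∀ j : Fin s, Nonempty
          ((FiltrationTheorem.factorRep (U j.castSucc) (U j.succ)).Equiv
            (FiltrationTheorem.higherLie ρ (l j))) := by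
  open FiltrationTheorem in
  refine ⟨isInternal_range_of_completeOrthogonalIdempotents
    (he.complete.map (placeRep F V r).asAlgebraHom.toRingHom), fun J s l hl hJ => ?_⟩
  have hmono : StrictMono fun i => sortedParts (l i) := hl
  -- The partitions which are lexicographically at least one of the partitions `l i` with `j ≤ i`.
  let Q : Fin (s + 1) → Set r.Partition :=
    fun j => {μ | ∃ i : Fin s, j ≤ i.castSucc ∧ sortedParts (l i) ≤ sortedParts μ}
  have hQ : ∀ j, IsLexUpper (Q j) := by
    rintro j μ ⟨i, hi, h⟩ θ hθ
    exact ⟨i, hi, h.trans (lexLT_iff.mp hθ).le⟩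
  have hx := (he.primitive J).1
  have hidem := he.complete.idem J
  refine ⟨fun j => placeImage ρ (e J) ⊓ lexSubrep ρ (Q j), ?_, ?_, ?_, fun j => ?_⟩
  · rintro j k hjk
    refine inf_le_inf le_rfl (lexSubmodule_mono ?_)
    rintro μ ⟨i, hi, h⟩
    exact ⟨i, hjk.trans hi, h⟩
  · have huniv : IsLexUpper (Set.univ : Set r.Partition) := fun _ _ _ _ => Set.mem_univ _
    have htop : lexSubrep ρ (Set.univ : Set r.Partition) = ⊤ :=
      Subrepresentation.toSubmodule_injective lexSubmodule_univ
    change placeImage ρ (e J) ⊓ lexSubrep ρ (Q 0) = _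
    rw [← placeImage_inf_lexSubrep_eq ρ huniv (hQ 0) (Set.subset_univ _) hx
      hidem, htop, inf_top_eq]
    intro σ _ hσ
    refine he.map_zero J σ fun h => hσ ?_
    obtain ⟨i, hi⟩ := (hJ _).mp h
    exact ⟨i, Fin.zero_le _, by rw [hi]⟩
  · have hlast : Q (Fin.last s) = ∅ := by
      rw [Set.eq_empty_iff_forall_notMem]
      rintro μ ⟨i, hi, -⟩
      exact absurd (Fin.castSucc_lt_last i) hi.not_gt
    have hbot : lexSubrep ρ (∅ : Set r.Partition) = ⊥ :=
      Subrepresentation.toSubmodule_injective lexSubmodule_empty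
    change placeImage ρ (e J) ⊓ lexSubrep ρ (Q (Fin.last s)) = ⊥
    rw [hlast, hbot, inf_bot_eq]
  · have h1 : Q j.castSucc = insert (l j) (lexAbove (l j)) := by
      ext μ
      rw [mem_insert_lexAbove]
      constructor
      · rintro ⟨i, hi, h⟩
        exact (hmono.monotone (Fin.castSucc_le_castSucc_iff.mp hi)).trans h
      · exact fun h => ⟨j, le_rfl, h⟩
    have h2 : Q j.succ ⊆ lexAbove (l j) := by
      rintro μ ⟨i, hi, h⟩
      exact (hmono (Fin.castSucc_lt_castSucc_iff.mp (Fin.castSucc_lt_succ.trans_le hi))).trans_le h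
    -- The partitions in `J` above `l j` are `l i` with `j < i`.
    have h3 : placeImage ρ (e J) ⊓ lexSubrep ρ (Q j.succ) =
        placeImage ρ (e J) ⊓ lexSubrep ρ (lexAbove (l j)) := by
      refine (placeImage_inf_lexSubrep_eq ρ (isLexUpper_lexAbove _) (hQ _) h2 hx hidem ?_).symm
      intro σ hσ hσ'
      refine he.map_zero J σ fun h => hσ' ?_
      obtain ⟨i, hi⟩ := (hJ _).mp h
      have hji : j < i := hmono.lt_iff_lt.mp (by
        rw [← hi] at hσ
        exact hσ)
      exact ⟨i, Fin.succ_le_castSucc_iff.mpr hji, by rw [hi]⟩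
    change Nonempty ((factorRep (placeImage ρ (e J) ⊓ lexSubrep ρ (Q j.castSucc))
      (placeImage ρ (e J) ⊓ lexSubrep ρ (Q j.succ))).Equiv (higherLie ρ (l j)))
    rw [h1, h3]
    refine nonempty_factorRep_equiv_higherLie ρ hx hidem (l j) fun σ hσ => ?_
    exact he.map_one J σ ((hJ _).mpr ⟨j, hσ.symm⟩)
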